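/- Let $S=(\mathbb N,\min)$, i.e. $\mathbb N=\{1,2,3,\dots\}$ with the operation $mn=\min\{m,n\}$, let $\ell^1(S)$ be its convolution algebra over $\mathbb C$ (so $\delta_s*\delta_t=\delta_{st}$), and for a Banach algebra $A$ let $F(A)=WAP(A^*)^*$, where $WAP(A^*)$ is the space of those $f\in A^*$ for which the maps $A\to A^*$, $a\mapsto a\cdot f$ and $a\mapsto f\cdot a$, with $(a\cdot f)(x)=f(xa)$ and $(f\cdot a)(x)=f(ax)$, are weakly compact; $F(A)$ carries the first Arens product $(X\,\square\,Y)(f)=X(Y\cdot f)$, $(Y\cdot f)(a)=Y(f\cdot a)$, and is a dual Banach algebra with predual $WAP(A^*)$. For a dual Banach algebra $B$ with predual $B_*$ let $\mathrm{Tri}(B,B,B)$ be the algebra of matrices $\begin{pmatrix} a&x\\0&b\end{pmatrix}$ with $a,x,b\in B$, with norm $\|a\|+\|x\|+\|b\|$ and predual $B_*\oplus_\infty B_*\oplus_\infty B_*$. For a dual Banach algebra $B$ let $\sigma wc((B\hat\otimes B)^*)$ be the set of those $T\in (B\hat\otimes B)^*$ for which $a\mapsto a\cdot T$ and $a\mapsto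 T\cdot a$ are continuous from $B$ with the weak$^*$ topology $\sigma(B,B_*)$ to $(B\hat\otimes B)^*$ with its weak topology, and let $\pi_{\sigma wc}:(\sigma wc((B\hat\otimes B)^*))^*\to (B_*)^*=B$ be the adjoint of $f\mapsto f\circ\pi$, where $\pi(x\otimes y)=xy$. Call $B$ approximately Connes-biprojective if there is a (not necessarily bounded) net $(\rho_\alpha)$ of continuous $B$-bimodule morphisms $\rho_\alpha:B\to(\sigma wc((B\hat\otimes B)^*))^*$ such that $\pi_{\sigma wc}(\rho_\alpha(a))\to a$ in norm for every $a\in B$. Then $\mathrm{Tri}\big(F(\ell^1(S)),F(\ell^1(S)),F(\ell^1(S))\big)$ is not approximately Connes-biprojective. -/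

import Mathlib

universe u v w

noncomputable section

open Filter Topology

/-- The dual Banach space `E*` of a normed space `E`, with the operator norm. -/
abbrev NDual (E : Type u) [NormedAddCommGroup E] [NormedSpace ℂ E] : Type u := E →L[ℂ] ℂ

/-- Bounded operators between normed spaces, with the operator norm. -/
abbrev NHom (E : Type u) (F : Type v) [NormedAddCommGroup E] [NormedSpace ℂ E]
    [NormedAddCommGroup F] [NormedSpace ℂ F] : Type (max u v) := E →L[ℂ] F

/-! ### Weakly compact operators -/

/-- A bounded operator is weakly compact if it maps the closed unit ball onto a set whose closure
in the weak topology is weakly compact. -/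
def IsWeaklyCompact {A : Type u} {E : Type v} [NormedAddCommGroup A] [NormedSpace ℂ A]
    [NormedAddCommGroup E] [NormedSpace ℂ E] (T : A →L[ℂ] E) : Prop :=
  IsCompact (closure ((fun a : A => toWeakSpace ℂ E (T a)) '' Metric.closedBall 0 1))

section WeaklyCompact

variable {A : Type u} {E : Type v} [NormedAddCommGroup A] [NormedSpace ℂ A]
  [NormedAddCommGroup E] [NormedSpace ℂ E]

theorem exists_separating_of_notMem_closure {V : Type u} {D : Type v} [AddCommGroup V]
    [Module ℂ V] [AddCommGroup D] [Module ℂ D] (B : V →ₗ[ℂ] D →ₗ[ℂ] ℂ) (K : Set (WeakBilin B))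
    (hK : ∀ x ∈ K, ∀ z ∈ K, ∀ s t : ℝ, 0 ≤ s → 0 ≤ t → s + t = 1 → (s : ℂ) • x + (t : ℂ) • z ∈ K)
    (y : WeakBilin B) (hy : y ∉ closure K) :
    ∃ (f : D) (c : ℝ), (∀ k ∈ K, (B k f).re < c) ∧ c < (B y f).re := by
  have : IsScalarTower ℝ ℂ (WeakBilin B) := inferInstanceAs (IsScalarTower ℝ ℂ V)
  have : ContinuousSMul ℝ (WeakBilin B) := IsScalarTower.continuousSMul ℂ
  have hconv : Convex ℝ K := fun x hx z hz s t hs ht hst => hK x hx z hz s t hs ht hst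
  obtain ⟨φ, c, h1, h2⟩ := RCLike.geometric_hahn_banach_closed_point (𝕜 := ℂ)
    (Convex.closure hconv) isClosed_closure hy
  obtain ⟨f, hf⟩ := LinearMap.dualEmbedding_surjective B φ
  subst hf
  exact ⟨f, c, fun k hk => h1 k (subset_closure hk), h2⟩

theorem norm_le_of_re_lt (f : NDual A) (c : ℝ) (h : ∀ a : A, ‖a‖ ≤ 1 → (f a).re < c) :
    ‖f‖ ≤ c := by
  have hc : 0 ≤ c := by simpa using (h 0 (by simp)).le
  refine ContinuousLinearMap.opNorm_le_of_unit_norm hc fun x hx => ?_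
  by_cases h0 : f x = 0
  · simpa [h0] using hc
  have hn : (‖f x‖ : ℂ) ≠ 0 := by simpa using h0
  have h1 := h (((starRingEnd ℂ) (f x) / ‖f x‖) • x) (by simp [norm_smul, hx, h0])
  rw [map_smul, smul_eq_mul, div_mul_eq_mul_div, mul_comm, Complex.mul_conj,
    Complex.normSq_eq_norm_sq] at h1
  have h2 : (((‖f x‖ ^ 2 : ℝ) : ℂ) / (‖f x‖ : ℂ)) = ((‖f x‖ : ℝ) : ℂ) := by
    push_cast
    field_simp
  rw [h2, Complex.ofReal_re] at h1
  exact h1.le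

theorem exists_ultrafilter_aux {V : Type v} {D : Type w} [AddCommGroup V]
    [Module ℂ V] [AddCommGroup D] [Module ℂ D] (B : V →ₗ[ℂ] D →ₗ[ℂ] ℂ) (i : A →ₗ[ℂ] V)
    (d : D → NDual A) (hd : ∀ a f, B (i a) f = d f a) (y : V) (hy : ∀ f, ‖B y f‖ ≤ ‖d f‖) :
    ∃ U : Ultrafilter A, Metric.closedBall (0 : A) 1 ∈ U ∧
      ∀ f : D, Tendsto (fun a => d f a) U (𝓝 (B y f)) := by
  let j : A → WeakBilin B := fun a => i a
  let y' : WeakBilin B := y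
  have key : y' ∈ closure (j '' Metric.closedBall 0 1) := by
    by_contra hn
    have hconv : ∀ x ∈ j '' Metric.closedBall 0 1, ∀ z ∈ j '' Metric.closedBall 0 1, ∀ s t : ℝ,
        0 ≤ s → 0 ≤ t → s + t = 1 → (s : ℂ) • x + (t : ℂ) • z ∈ j '' Metric.closedBall 0 1 := by
      rintro _ ⟨x, hx, rfl⟩ _ ⟨z, hz, rfl⟩ s t hs ht hst
      refine ⟨(s : ℂ) • x + (t : ℂ) • z, ?_, ?_⟩
      · exact (convex_closedBall (0 : A) 1) hx hz hs ht hst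
      · refine (map_add i _ _).trans ?_
        rw [map_smul, map_smul]
        rfl
    obtain ⟨f, c, h1, h2⟩ := exists_separating_of_notMem_closure B _ hconv y' hn
    have h5 : ‖d f‖ ≤ c := norm_le_of_re_lt (d f) c fun a ha => by
      rw [← hd]
      exact h1 (j a) (Set.mem_image_of_mem j (mem_closedBall_zero_iff.2 ha))
    have h6 : (B y f).re ≤ ‖B y f‖ := Complex.re_le_norm _
    exact absurd (h2.trans_le (h6.trans ((hy f).trans h5))) (lt_irrefl c)
  have h0 : MapClusterPt y' (𝓟 (Metric.closedBall (0 : A) 1)) j := by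
    rw [MapClusterPt, map_principal]; exact mem_closure_iff_clusterPt.1 key
  obtain ⟨U, hU, hlim⟩ := mapClusterPt_iff_ultrafilter.1 h0
  refine ⟨U, le_principal_iff.1 hU, fun f => ?_⟩
  have h1 : Tendsto (fun a => B (i a) f) U (𝓝 (B y f)) :=
    ((WeakBilin.eval_continuous B f).tendsto y').comp hlim
  simpa only [hd] using h1

theorem exists_ultrafilter_of_bidual (Y : NDual (NDual A)) (hY : ‖Y‖ ≤ 1) :
    ∃ U : Ultrafilter A, Metric.closedBall (0 : A) 1 ∈ U ∧
      ∀ f : NDual A, Tendsto (fun a => f a) U (𝓝 (Y f)) :=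
  exists_ultrafilter_aux (V := NDual (NDual A)) (D := NDual A)
    (ContinuousLinearMap.coeLM ℂ) (NormedSpace.inclusionInDoubleDual ℂ A).toLinearMap id
    (fun _ _ => rfl) Y (fun f => (Y.le_opNorm f).trans
      ((mul_le_mul_of_nonneg_right hY (norm_nonneg f)).trans_eq (one_mul _)))

/-- For a weakly compact `T : A → E*`, iterated limits against `A**` and `E**` commute. -/
theorem isWeaklyCompact_iff (T : A →L[ℂ] NDual E) :
    IsWeaklyCompact T ↔ ∀ (Y : NDual (NDual A))
      (Φ : NDual (NDual E)), Y (Φ.comp T) = Φ (Y.comp T.flip) := by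
  constructor
  · intro hT
    have main : ∀ (Y : NDual (NDual A)), ‖Y‖ ≤ 1 →
        ∀ (Φ : NDual (NDual E)), Y (Φ.comp T) = Φ (Y.comp T.flip) := by
      intro Y hY
      obtain ⟨U, hU, hlim⟩ := exists_ultrafilter_of_bidual Y hY
      obtain ⟨k, -, hk⟩ := hT.ultrafilter_le_nhds
        (U.map fun a : A => toWeakSpace ℂ (NDual E) (T a)) (by
          rw [le_principal_iff]
          exact mem_of_superset (image_mem_map hU) subset_closure)
      have hk' : ∀ Φ : NDual (NDual E),
          Φ ((toWeakSpace ℂ (NDual E)).symm k) = Y (Φ.comp T) := by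
        intro Φ
        have h1 : Tendsto (fun a => Φ (T a)) U
            (𝓝 (Φ ((toWeakSpace ℂ (NDual E)).symm k))) :=
          ((WeakBilin.eval_continuous (topDualPairing ℂ (NDual E)).flip Φ).tendsto k).comp
            hk
        exact tendsto_nhds_unique h1 (hlim (Φ.comp T))
      have hk2 : (toWeakSpace ℂ (NDual E)).symm k = Y.comp T.flip := by
        ext e
        exact hk' (NormedSpace.inclusionInDoubleDual ℂ E e)
      intro Φ
      rw [← hk', hk2]
    intro Y Φ
    by_cases hY : ‖Y‖ = 0
    · have hY0 : Y = 0 := norm_eq_zero.1 hY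
      subst hY0
      rw [ContinuousLinearMap.zero_comp, map_zero, zero_apply]
    · have hne : ((‖Y‖⁻¹ : ℝ) : ℂ) ≠ 0 := by simpa using hY
      have h := main (((‖Y‖⁻¹ : ℝ) : ℂ) • Y) (by
        rw [norm_smul, Complex.norm_real, norm_inv, norm_norm, inv_mul_cancel₀ hY]) Φ
      rw [ContinuousLinearMap.smul_comp, map_smul, smul_apply] at h
      exact smul_right_injective ℂ hne h
  · intro h
    let S : WeakDual ℂ (NDual A) → WeakSpace ℂ (NDual E) := fun Y =>
      toWeakSpace ℂ (NDual E) ((WeakDual.toStrongDual Y).comp T.flip)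
    have hS : Continuous S := by
      refine WeakBilin.continuous_of_continuous_eval _ fun Φ => ?_
      have : (fun Y : WeakDual ℂ (NDual A) => Y (Φ.comp T)) =
          fun Y => (topDualPairing ℂ (NDual E)).flip (S Y) Φ := by
        ext Y
        exact h (WeakDual.toStrongDual Y) Φ
      rw [← this]
      exact WeakDual.eval_continuous _
    have hc := (WeakDual.isCompact_closedBall (0 : NDual (NDual A)) 1).image hS
    refine hc.closure_of_subset ?_
    rintro _ ⟨a, ha, rfl⟩
    refine ⟨StrongDual.toWeakDual (NormedSpace.inclusionInDoubleDual ℂ A a), ?_, rfl⟩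
    simp only [Set.mem_preimage, mem_closedBall_zero_iff] at ha ⊢
    exact (NormedSpace.double_dual_bound ℂ A a).trans ha

end WeaklyCompact

/-! ### Module actions on the dual, weakly almost periodic functionals, and `F(A) = WAP(A*)*` -/

section WAP

variable {A : Type u} [NonUnitalNormedRing A] [NormedSpace ℂ A] [IsScalarTower ℂ A A]
  [SMulCommClass ℂ A A]

/-- The map `A → A*`, `a ↦ a · f`, where `(a · f)(x) = f (x a)`. -/
def leftOrbit (f : NDual A) : A →L[ℂ] NDual A :=
  (ContinuousLinearMap.compL ℂ A A ℂ f).comp (ContinuousLinearMap.mul ℂ A).flip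

/-- The map `A → A*`, `a ↦ f · a`, where `(f · a)(x) = f (a x)`. -/
def rightOrbit (f : NDual A) : A →L[ℂ] NDual A :=
  (ContinuousLinearMap.compL ℂ A A ℂ f).comp (ContinuousLinearMap.mul ℂ A)

@[simp] theorem leftOrbit_apply (f : NDual A) (a x : A) : leftOrbit f a x = f (x * a) := rfl

@[simp] theorem rightOrbit_apply (f : NDual A) (a x : A) : rightOrbit f a x = f (a * x) := rfl

theorem norm_leftOrbit_le (f : NDual A) (a : A) : ‖leftOrbit f a‖ ≤ ‖f‖ * ‖a‖ := by
  refine ContinuousLinearMap.opNorm_le_bound _ (by positivity) fun x => ?_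
  calc ‖f (x * a)‖ ≤ ‖f‖ * ‖x * a‖ := f.le_opNorm _
    _ ≤ ‖f‖ * (‖x‖ * ‖a‖) := by gcongr; exact norm_mul_le x a
    _ = ‖f‖ * ‖a‖ * ‖x‖ := by ring

theorem norm_rightOrbit_le (f : NDual A) (a : A) : ‖rightOrbit f a‖ ≤ ‖f‖ * ‖a‖ := by
  refine ContinuousLinearMap.opNorm_le_bound _ (by positivity) fun x => ?_
  calc ‖f (a * x)‖ ≤ ‖f‖ * ‖a * x‖ := f.le_opNorm _
    _ ≤ ‖f‖ * (‖a‖ * ‖x‖) := by gcongr; exact norm_mul_le a x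
    _ = ‖f‖ * ‖a‖ * ‖x‖ := by ring

theorem isWeaklyAlmostPeriodic_iff (f : NDual A) :
    IsWeaklyCompact (leftOrbit f) ∧ IsWeaklyCompact (rightOrbit f) ↔
      ∀ X Y : NDual (NDual A), X (Y.comp (rightOrbit f)) = Y (X.comp (leftOrbit f)) := by
  have h1 : (leftOrbit f).flip = rightOrbit f := rfl
  have h2 : (rightOrbit f).flip = leftOrbit f := rfl
  rw [isWeaklyCompact_iff, isWeaklyCompact_iff, h1, h2]
  exact ⟨fun h X Y => h.2 X Y, fun h => ⟨fun Y X => (h X Y).symm, h⟩⟩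

variable (A) in
/-- `WAP(A*)`: the functionals `f` on `A` for which `a ↦ a · f` and `a ↦ f · a` are weakly
compact. -/
def WAP : Submodule ℂ (NDual A) where
  carrier := {f | IsWeaklyCompact (leftOrbit f) ∧ IsWeaklyCompact (rightOrbit f)}
  zero_mem' := (isWeaklyAlmostPeriodic_iff 0).2 fun X Y => by
    have h1 : leftOrbit (0 : NDual A) = 0 := rfl
    have h2 : rightOrbit (0 : NDual A) = 0 := rfl
    rw [h1, h2, ContinuousLinearMap.comp_zero, ContinuousLinearMap.comp_zero, map_zero, map_zero]
  add_mem' {f g} hf hg := (isWeaklyAlmostPeriodic_iff (f + g)).2 fun X Y => by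
    have h1 : leftOrbit (f + g) = leftOrbit f + leftOrbit g := rfl
    have h2 : rightOrbit (f + g) = rightOrbit f + rightOrbit g := rfl
    rw [h1, h2, ContinuousLinearMap.comp_add, ContinuousLinearMap.comp_add, map_add, map_add,
      (isWeaklyAlmostPeriodic_iff f).1 hf, (isWeaklyAlmostPeriodic_iff g).1 hg]
  smul_mem' c f hf := (isWeaklyAlmostPeriodic_iff (c • f)).2 fun X Y => by
    have h1 : leftOrbit (c • f) = c • leftOrbit f := rfl
    have h2 : rightOrbit (c • f) = c • rightOrbit f := rfl
    rw [h1, h2, ContinuousLinearMap.comp_smul, ContinuousLinearMap.comp_smul, map_smul, map_smul,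
      (isWeaklyAlmostPeriodic_iff f).1 hf]

theorem mem_WAP_iff (f : NDual A) : f ∈ WAP A ↔
    ∀ X Y : NDual (NDual A), X (Y.comp (rightOrbit f)) = Y (X.comp (leftOrbit f)) :=
  isWeaklyAlmostPeriodic_iff f

theorem isClosed_WAP : IsClosed (WAP A : Set (NDual A)) := by
  have h : (WAP A : Set (NDual A)) = ⋂ (X : NDual (NDual A)) (Y : NDual (NDual A)),
      {f | X (Y.comp (rightOrbit f)) = Y (X.comp (leftOrbit f))} := by
    ext f
    simp only [SetLike.mem_coe, mem_WAP_iff, Set.mem_iInter]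
    rfl
  rw [h]
  have c1 : Continuous (fun f : NDual A => leftOrbit f) :=
    ((ContinuousLinearMap.compL ℂ A A ℂ).continuous).clm_comp continuous_const
  have c2 : Continuous (fun f : NDual A => rightOrbit f) :=
    ((ContinuousLinearMap.compL ℂ A A ℂ).continuous).clm_comp continuous_const
  refine isClosed_iInter fun X => isClosed_iInter fun Y => isClosed_eq ?_ ?_
  · exact X.continuous.comp (continuous_const.clm_comp c2)
  · exact Y.continuous.comp (continuous_const.clm_comp c1)

/-- Right translation `f ↦ f · a` on `A*`. -/
def rightTrans (a : A) : NDual A →L[ℂ] NDual A :=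
  (ContinuousLinearMap.compL ℂ A A ℂ).flip (ContinuousLinearMap.mul ℂ A a)

/-- Left translation `f ↦ a · f` on `A*`. -/
def leftTrans (a : A) : NDual A →L[ℂ] NDual A :=
  (ContinuousLinearMap.compL ℂ A A ℂ).flip ((ContinuousLinearMap.mul ℂ A).flip a)

theorem rightOrbit_mem_WAP {f : NDual A} (hf : f ∈ WAP A) (a : A) : rightOrbit f a ∈ WAP A := by
  rw [mem_WAP_iff] at hf ⊢
  intro X Y
  have h1 : Y.comp (rightOrbit (rightOrbit f a)) = rightTrans a (Y.comp (rightOrbit f)) := by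
    ext x
    change Y (rightOrbit (rightOrbit f a) x) = Y (rightOrbit f (a * x))
    congr 1
    ext y
    simp [mul_assoc]
  have h2 : X.comp (leftOrbit (rightOrbit f a)) = (X.comp (rightTrans a)).comp (leftOrbit f) := by
    ext x
    change X (leftOrbit (rightOrbit f a) x) = X (rightTrans a (leftOrbit f x))
    congr 1
    ext y
    change f (a * (y * x)) = f (a * y * x)
    rw [mul_assoc]
  rw [h1, h2]
  exact hf (X.comp (rightTrans a)) Y

theorem leftOrbit_mem_WAP {f : NDual A} (hf : f ∈ WAP A) (a : A) : leftOrbit f a ∈ WAP A := by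
  rw [mem_WAP_iff] at hf ⊢
  intro X Y
  have h1 : X.comp (leftOrbit (leftOrbit f a)) = leftTrans a (X.comp (leftOrbit f)) := by
    ext x
    change X (leftOrbit (leftOrbit f a) x) = X (leftOrbit f (x * a))
    congr 1
    ext y
    simp [mul_assoc]
  have h2 : Y.comp (rightOrbit (leftOrbit f a)) = (Y.comp (leftTrans a)).comp (rightOrbit f) := by
    ext x
    change Y (rightOrbit (leftOrbit f a) x) = Y (leftTrans a (rightOrbit f x))
    congr 1
    ext y
    change f (x * y * a) = f (x * (y * a))
    rw [mul_assoc]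
  rw [h1, h2]
  exact hf X (Y.comp (leftTrans a))

/-- The map `A → WAP(A*)`, `a ↦ f · a`, for `f ∈ WAP(A*)`. -/
def rightOrbitW (f : WAP A) : A →L[ℂ] WAP A :=
  (rightOrbit (f : NDual A)).codRestrict (WAP A) (rightOrbit_mem_WAP f.2)

/-- The map `A → WAP(A*)`, `a ↦ a · f`, for `f ∈ WAP(A*)`. -/
def leftOrbitW (f : WAP A) : A →L[ℂ] WAP A :=
  (leftOrbit (f : NDual A)).codRestrict (WAP A) (leftOrbit_mem_WAP f.2)

theorem exists_extension_WAP (X : NDual (WAP A)) :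
    ∃ X' : NDual (NDual A), ∀ f : WAP A, X' f = X f := by
  obtain ⟨g, hg, -⟩ := exists_extension_norm_eq (WAP A) X
  exact ⟨g, hg⟩

theorem wap_swap (f : WAP A) (X Y : NDual (WAP A)) (h1 : Y.comp (rightOrbitW f) ∈ WAP A)
    (h2 : X.comp (leftOrbitW f) ∈ WAP A) : X ⟨_, h1⟩ = Y ⟨_, h2⟩ := by
  obtain ⟨X', hX⟩ := exists_extension_WAP X
  obtain ⟨Y', hY⟩ := exists_extension_WAP Y
  have e1 : Y.comp (rightOrbitW f) = Y'.comp (rightOrbit (f : NDual A)) := by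
    ext a; exact (hY (rightOrbitW f a)).symm
  have e2 : X.comp (leftOrbitW f) = X'.comp (leftOrbit (f : NDual A)) := by
    ext a; exact (hX (leftOrbitW f a)).symm
  rw [← hX, ← hY]
  change X' (Y.comp (rightOrbitW f)) = Y' (X.comp (leftOrbitW f))
  rw [e1, e2]
  exact (mem_WAP_iff _).1 f.2 X' Y'

theorem bidual_assoc {f : NDual A} (hf : f ∈ WAP A) (X Y : NDual (NDual A)) :
    X.comp (leftOrbit (Y.comp (rightOrbit f))) = Y.comp (rightOrbit (X.comp (leftOrbit f))) := by
  ext a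
  have e1 : leftOrbit (Y.comp (rightOrbit f)) a = leftTrans a (Y.comp (rightOrbit f)) := rfl
  have e2 : rightOrbit (X.comp (leftOrbit f)) a = (X.comp (leftTrans a)).comp (leftOrbit f) := by
    ext x
    change X (leftOrbit f (a * x)) = X (leftTrans a (leftOrbit f x))
    congr 1
    ext y
    change f (y * (a * x)) = f (y * a * x)
    rw [mul_assoc]
  change X (leftOrbit (Y.comp (rightOrbit f)) a) = Y (rightOrbit (X.comp (leftOrbit f)) a)
  rw [e1, e2]
  exact (mem_WAP_iff f).1 hf (X.comp (leftTrans a)) Y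

/-- `WAP(A*)` is introverted: `Y · f` is weakly almost periodic if `f` is. -/
theorem bidual_left_mem {f : NDual A} (hf : f ∈ WAP A) (Y : NDual (NDual A)) :
    Y.comp (rightOrbit f) ∈ WAP A := by
  rw [mem_WAP_iff]
  intro X Z
  let ZY : NDual (NDual A) := Z.comp
    (((ContinuousLinearMap.compL ℂ A (NDual A) ℂ) Y).comp
      (((ContinuousLinearMap.compL ℂ A (A →L[ℂ] A) (NDual A)).flip
        (ContinuousLinearMap.mul ℂ A)).comp (ContinuousLinearMap.compL ℂ A A ℂ)))
  have hZY : ∀ g, ZY g = Z (Y.comp (rightOrbit g)) := fun g => rfl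
  have h1 : Z.comp (rightOrbit (Y.comp (rightOrbit f))) = ZY.comp (rightOrbit f) := by
    ext a
    change Z (rightOrbit (Y.comp (rightOrbit f)) a) = ZY (rightOrbit f a)
    rw [hZY]
    congr 1
    ext x
    change Y (rightOrbit f (a * x)) = Y (rightOrbit (rightOrbit f a) x)
    congr 1
    ext y
    simp [mul_assoc]
  rw [h1, bidual_assoc hf, (mem_WAP_iff f).1 hf X ZY, hZY]

theorem bidual_right_mem {f : NDual A} (hf : f ∈ WAP A) (X : NDual (NDual A)) :
    X.comp (leftOrbit f) ∈ WAP A := by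
  rw [mem_WAP_iff]
  intro Z W
  let XZ : NDual (NDual A) := Z.comp
    (((ContinuousLinearMap.compL ℂ A (NDual A) ℂ) X).comp
      (((ContinuousLinearMap.compL ℂ A (A →L[ℂ] A) (NDual A)).flip
        (ContinuousLinearMap.mul ℂ A).flip).comp (ContinuousLinearMap.compL ℂ A A ℂ)))
  have hXZ : ∀ g, XZ g = Z (X.comp (leftOrbit g)) := fun g => rfl
  have h1 : Z.comp (leftOrbit (X.comp (leftOrbit f))) = XZ.comp (leftOrbit f) := by
    ext a
    change Z (leftOrbit (X.comp (leftOrbit f)) a) = XZ (leftOrbit f a)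
    rw [hXZ]
    congr 1
    ext x
    change X (leftOrbit f (x * a)) = X (leftOrbit (leftOrbit f a) x)
    congr 1
    ext y
    simp [mul_assoc]
  rw [h1, ← bidual_assoc hf, ← (mem_WAP_iff f).1 hf XZ W, hXZ]

theorem left_mem_WAP (f : WAP A) (Y : NDual (WAP A)) : Y.comp (rightOrbitW f) ∈ WAP A := by
  obtain ⟨Y', hY⟩ := exists_extension_WAP Y
  have e1 : Y.comp (rightOrbitW f) = Y'.comp (rightOrbit (f : NDual A)) := by
    ext a; exact (hY (rightOrbitW f a)).symm
  rw [e1]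
  exact bidual_left_mem f.2 Y'

theorem right_mem_WAP (f : WAP A) (X : NDual (WAP A)) : X.comp (leftOrbitW f) ∈ WAP A := by
  obtain ⟨X', hX⟩ := exists_extension_WAP X
  have e1 : X.comp (leftOrbitW f) = X'.comp (leftOrbit (f : NDual A)) := by
    ext a; exact (hX (leftOrbitW f a)).symm
  rw [e1]
  exact bidual_right_mem f.2 X'


end WAP

section WAP

variable {A : Type u} [NonUnitalNormedRing A] [NormedSpace ℂ A] [IsScalarTower ℂ A A]
  [SMulCommClass ℂ A A]

/-- `f ↦ Y · f` on `WAP(A*)`, where `(Y · f)(a) = Y (f · a)`. -/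
def bidualLeft (Y : NDual (WAP A)) : NHom (WAP A) (WAP A) :=
  LinearMap.mkContinuous (E := WAP A) (F := WAP A) (σ := RingHom.id ℂ)
    { toFun := fun f => ⟨Y.comp (rightOrbitW f), left_mem_WAP f Y⟩
      map_add' := fun (f g : WAP A) => Subtype.ext <| ContinuousLinearMap.ext fun a =>
        map_add Y (rightOrbitW f a) (rightOrbitW g a)
      map_smul' := fun (c : ℂ) (f : WAP A) => Subtype.ext <| ContinuousLinearMap.ext fun a =>
        map_smul Y c (rightOrbitW f a) } ‖Y‖ fun f => by
    refine ContinuousLinearMap.opNorm_le_bound _ (by positivity) fun a => ?_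
    calc ‖Y (rightOrbitW f a)‖ ≤ ‖Y‖ * ‖rightOrbitW f a‖ := Y.le_opNorm _
      _ ≤ ‖Y‖ * (‖f‖ * ‖a‖) := by
        gcongr
        exact norm_rightOrbit_le (f : NDual A) a
      _ = ‖Y‖ * ‖f‖ * ‖a‖ := by ring

theorem bidualLeft_coe (Y : NDual (WAP A)) (f : WAP A) :
    (bidualLeft Y f : NDual A) = Y.comp (rightOrbitW f) := rfl

theorem bidualLeft_apply (Y : NDual (WAP A)) (f : WAP A) (a : A) :
    (bidualLeft Y f : NDual A) a = Y (rightOrbitW f a) := rfl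

theorem norm_bidualLeft_le (Y : NDual (WAP A)) : ‖bidualLeft Y‖ ≤ ‖Y‖ :=
  LinearMap.mkContinuous_norm_le _ (norm_nonneg Y) _

theorem bidualLeft_comp (Y Z : NDual (WAP A)) :
    bidualLeft (Y.comp (bidualLeft Z)) = (bidualLeft Y).comp (bidualLeft Z) := by
  refine ContinuousLinearMap.ext fun f => Subtype.ext <| ContinuousLinearMap.ext fun a => ?_
  change Y (bidualLeft Z (rightOrbitW f a)) = Y (rightOrbitW (bidualLeft Z f) a)
  congr 1
  refine Subtype.ext <| ContinuousLinearMap.ext fun x => ?_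
  change Z (rightOrbitW (rightOrbitW f a) x) = Z (rightOrbitW f (a * x))
  congr 1
  refine Subtype.ext <| ContinuousLinearMap.ext fun y => ?_
  change (f : NDual A) (a * (x * y)) = (f : NDual A) (a * x * y)
  rw [mul_assoc]

end WAP

section WAP

variable {A : Type u} [NonUnitalNormedRing A] [NormedSpace ℂ A] [IsScalarTower ℂ A A]
  [SMulCommClass ℂ A A]

variable (A) in
/-- The Banach space `F(A) = WAP(A*)*`. -/
def WAPDual : Type u := NDual (WAP A)

namespace WAPDual

instance : NormedAddCommGroup (WAPDual A) := inferInstanceAs (NormedAddCommGroup (NDual (WAP A)))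

instance : NormedSpace ℂ (WAPDual A) := inferInstanceAs (NormedSpace ℂ (NDual (WAP A)))

instance : CompleteSpace (WAPDual A) := inferInstanceAs (CompleteSpace (NDual (WAP A)))

variable (A) in
/-- `F(A)` is by definition the dual of `WAP(A*)`. -/
def toDual : WAPDual A ≃ₗᵢ[ℂ] NDual (WAP A) := LinearIsometryEquiv.refl ℂ (NDual (WAP A))

/-- The first Arens product: `(X □ Y)(f) = X (Y · f)`, `(Y · f)(a) = Y (f · a)`. -/
instance : Mul (WAPDual A) :=
  ⟨fun X Y => (toDual A).symm ((toDual A X).comp (bidualLeft (toDual A Y)))⟩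

theorem toDual_mul (X Y : WAPDual A) :
    toDual A (X * Y) = (toDual A X).comp (bidualLeft (toDual A Y)) := rfl

theorem toDual_mul_apply (X Y : WAPDual A) (f : WAP A) :
    toDual A (X * Y) f = toDual A X (bidualLeft (toDual A Y) f) := rfl

theorem ext_apply {X Y : WAPDual A} (h : ∀ f, toDual A X f = toDual A Y f) : X = Y :=
  (toDual A).injective (ContinuousLinearMap.ext h)

theorem norm_mul_le' (X Y : WAPDual A) : ‖X * Y‖ ≤ ‖X‖ * ‖Y‖ := by
  have h1 : ‖X * Y‖ ≤ ‖toDual A X‖ * ‖bidualLeft (toDual A Y)‖ :=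
    ContinuousLinearMap.opNorm_comp_le (toDual A X) (bidualLeft (toDual A Y))
  exact h1.trans (mul_le_mul_of_nonneg_left (norm_bidualLeft_le (toDual A Y))
    (norm_nonneg (toDual A X)))

instance : NonUnitalRing (WAPDual A) where
  left_distrib X Y Z := ext_apply fun f =>
    (toDual A X).map_add (bidualLeft (toDual A Y) f) (bidualLeft (toDual A Z) f)
  right_distrib _ _ _ := rfl
  zero_mul _ := rfl
  mul_zero X := ext_apply fun _ => (toDual A X).map_zero
  mul_assoc X Y Z := ext_apply fun f => by
    change toDual A X (bidualLeft (toDual A Y) (bidualLeft (toDual A Z) f)) =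
      toDual A X (bidualLeft ((toDual A Y).comp (bidualLeft (toDual A Z))) f)
    rw [bidualLeft_comp]
    rfl

instance : NonUnitalNormedRing (WAPDual A) where
  dist_eq X Y := NormedAddGroup.dist_eq X Y
  norm_mul_le := norm_mul_le'

instance : IsScalarTower ℂ (WAPDual A) (WAPDual A) :=
  ⟨fun _ _ _ => rfl⟩

instance : SMulCommClass ℂ (WAPDual A) (WAPDual A) :=
  ⟨fun c X Y => ext_apply fun f =>
    ((toDual A X).map_smul c (bidualLeft (toDual A Y) f)).symm⟩

end WAPDual

end WAP

/-! ### Dual Banach algebras -/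

/-- Evaluation `A → P*`, `a ↦ (f ↦ f a)`, for a subspace `P` of `A*`. -/
def evalOn {A : Type u} [NormedAddCommGroup A] [NormedSpace ℂ A] (P : Submodule ℂ (NDual A)) :
    A →L[ℂ] NDual P :=
  ((ContinuousLinearMap.compL ℂ P (NDual A) ℂ).flip P.subtypeL).comp
    (NormedSpace.inclusionInDoubleDual ℂ A)

theorem evalOn_apply {A : Type u} [NormedAddCommGroup A] [NormedSpace ℂ A]
    (P : Submodule ℂ (NDual A)) (a : A) (f : P) : evalOn P a f = (f : NDual A) a := rfl

/-- A dual Banach algebra: a Banach algebra `A` together with a closed subbimodule `A_*` of `A*`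
such that `A = (A_*)*` isometrically through evaluation. -/
class DualBanachAlgebra (A : Type u) [NonUnitalNormedRing A] [NormedSpace ℂ A]
    [IsScalarTower ℂ A A] [SMulCommClass ℂ A A] where
  /-- the predual `A_*` -/
  predual : Submodule ℂ (NDual A)
  isClosed_predual : IsClosed (predual : Set (NDual A))
  leftOrbit_mem : ∀ f ∈ predual, ∀ a : A, leftOrbit f a ∈ predual
  rightOrbit_mem : ∀ f ∈ predual, ∀ a : A, rightOrbit f a ∈ predual
  norm_evalOn : ∀ a : A, ‖evalOn predual a‖ = ‖a‖
  evalOn_surjective : Function.Surjective (evalOn predual)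

section WAPDualPredual

variable {A : Type u} [NonUnitalNormedRing A] [NormedSpace ℂ A] [IsScalarTower ℂ A A]
  [SMulCommClass ℂ A A]

namespace WAPDual

variable (A) in
/-- The canonical isometry `WAP(A*) → F(A)*`. -/
def evalW : WAP A →ₗᵢ[ℂ] NDual (WAPDual A) := NormedSpace.inclusionInDoubleDualLi ℂ

theorem evalW_apply (f : WAP A) (X : WAPDual A) : evalW A f X = toDual A X f := rfl

/-- `F(A)` is a dual Banach algebra with predual `WAP(A*)`. -/
instance : DualBanachAlgebra (WAPDual A) where
  predual := LinearMap.range (evalW A).toLinearMap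
  isClosed_predual := by
    have : CompleteSpace (WAP A) := isClosed_WAP.completeSpace_coe
    have h := (evalW A).isometry.isClosedEmbedding.isClosed_range
    exact h
  leftOrbit_mem := by
    rintro _ ⟨f, rfl⟩ Y
    exact ⟨bidualLeft (toDual A Y) f, rfl⟩
  rightOrbit_mem := by
    rintro _ ⟨f, rfl⟩ X
    refine ⟨⟨(toDual A X).comp (leftOrbitW f), right_mem_WAP f _⟩, ?_⟩
    refine ContinuousLinearMap.ext fun Y => ?_
    exact (wap_swap f (toDual A X) (toDual A Y) _ _).symm
  norm_evalOn X := by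
    refine le_antisymm ?_ ?_
    · refine ContinuousLinearMap.opNorm_le_bound _ (norm_nonneg X) fun f => ?_
      rw [evalOn_apply, mul_comm]
      exact (f : NDual (WAPDual A)).le_opNorm X
    · refine ContinuousLinearMap.opNorm_le_bound (toDual A X) (norm_nonneg _) fun f => ?_
      have h := (evalOn (LinearMap.range (evalW A).toLinearMap) X).le_opNorm ⟨evalW A f, f, rfl⟩
      refine h.trans_eq ?_
      congr 1
      exact (evalW A).norm_map f
  evalOn_surjective := by
    intro Φ
    refine ⟨(toDual A).symm (Φ.comp ((evalW A).toContinuousLinearMap.codRestrict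
      (LinearMap.range (evalW A).toLinearMap) fun f => ⟨f, rfl⟩)), ?_⟩
    refine ContinuousLinearMap.ext ?_
    rintro ⟨_, f, rfl⟩
    rfl

end WAPDual

end WAPDualPredual

open scoped TensorProduct

/-! ### The projective tensor product `A ⊗̂ A` -/

section ProjTensor

/-- The projective tensor product `A ⊗̂ A`: the completion of the algebraic tensor product in the
projective norm. -/
def ProjTensor (A : Type u) [NormedAddCommGroup A] [NormedSpace ℂ A] : Type u :=
  UniformSpace.Completion (⨂[ℂ] _ : Fin 2, A)

namespace ProjTensor

variable {A : Type u} [NormedAddCommGroup A] [NormedSpace ℂ A]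
variable {G : Type v} [NormedAddCommGroup G] [NormedSpace ℂ G]

instance : NormedAddCommGroup (ProjTensor A) :=
  inferInstanceAs (NormedAddCommGroup (UniformSpace.Completion (⨂[ℂ] _ : Fin 2, A)))

instance : NormedSpace ℂ (ProjTensor A) :=
  inferInstanceAs (NormedSpace ℂ (UniformSpace.Completion (⨂[ℂ] _ : Fin 2, A)))

instance : CompleteSpace (ProjTensor A) :=
  inferInstanceAs (CompleteSpace (UniformSpace.Completion (⨂[ℂ] _ : Fin 2, A)))

variable (A) in
/-- The inclusion of the algebraic tensor product. -/
def incl : (⨂[ℂ] _ : Fin 2, A) →L[ℂ] ProjTensor A :=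
  UniformSpace.Completion.toComplL (𝕜 := ℂ) (E := ⨂[ℂ] _ : Fin 2, A)

/-- The elementary tensor `x ⊗ y`. -/
def tmul (x y : A) : ProjTensor A := incl A (PiTensorProduct.tprod ℂ ![x, y])

/-- A bounded bilinear map as a multilinear map in two variables. -/
def uncurry (B : NHom A (NHom A G)) : ContinuousMultilinearMap ℂ (fun _ : Fin 2 => A) G :=
  MultilinearMap.mkContinuous
    { toFun := fun m => B (m 0) (m 1)
      map_update_add' := fun {inst} m i x y => by
        rw [Subsingleton.elim inst (instDecidableEqFin 2)]
        fin_cases i <;> simp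
      map_update_smul' := fun {inst} m i c x => by
        rw [Subsingleton.elim inst (instDecidableEqFin 2)]
        fin_cases i <;> simp } ‖B‖ fun m => by
    rw [Fin.prod_univ_two, ← mul_assoc]
    exact B.le_opNorm₂ (m 0) (m 1)

theorem uncurry_apply (B : NHom A (NHom A G)) (m : Fin 2 → A) : uncurry B m = B (m 0) (m 1) := rfl

theorem hom_ext {S T : NHom (ProjTensor A) G} (h : ∀ x y, S (tmul x y) = T (tmul x y)) :
    S = T := by
  have h1 : S.comp (incl A) = T.comp (incl A) := by
    refine ContinuousLinearMap.coe_injective (PiTensorProduct.ext (MultilinearMap.ext fun m => ?_))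
    have hm : m = ![m 0, m 1] := by ext i; fin_cases i <;> rfl
    have := h (m 0) (m 1)
    rw [hm]
    exact this
  refine ContinuousLinearMap.ext fun z => ?_
  refine UniformSpace.Completion.induction_on z (isClosed_eq S.continuous T.continuous) fun t => ?_
  exact congrArg (fun f => f t) h1

variable [CompleteSpace G]

/-- The bounded linear map on `A ⊗̂ A` induced by a bounded bilinear map. -/
def lift (B : NHom A (NHom A G)) : NHom (ProjTensor A) G :=
  (PiTensorProduct.liftIsometry ℂ (fun _ : Fin 2 => A) G (uncurry B)).extend (incl A)

theorem lift_tmul (B : NHom A (NHom A G)) (x y : A) : lift B (tmul x y) = B x y := by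
  have h := ContinuousLinearMap.extend_eq
    (PiTensorProduct.liftIsometry ℂ (fun _ : Fin 2 => A) G (uncurry B)) (e := incl A)
    UniformSpace.Completion.denseRange_coe
    (UniformSpace.Completion.isUniformInducing_coe _) (PiTensorProduct.tprod ℂ ![x, y])
  refine h.trans ?_
  rw [PiTensorProduct.liftIsometry_apply_apply, PiTensorProduct.lift.tprod]
  rfl

end ProjTensor

end ProjTensor

section ProjTensorAlgebra

namespace ProjTensor

variable {A : Type u} [NormedAddCommGroup A] [NormedSpace ℂ A]

theorem tmul_eq_tprod (m : Fin 2 → A) : incl A (PiTensorProduct.tprod ℂ m) = tmul (m 0) (m 1) := by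
  have hm : m = ![m 0, m 1] := by ext i; fin_cases i <;> rfl
  exact congrArg (fun m => incl A (PiTensorProduct.tprod ℂ m)) hm

theorem norm_tmul_le (x y : A) : ‖tmul x y‖ ≤ ‖x‖ * ‖y‖ := by
  have h := PiTensorProduct.projectiveSeminorm_tprod_le (𝕜 := ℂ) ![x, y]
  rw [Fin.prod_univ_two] at h
  exact (UniformSpace.Completion.norm_coe _).le.trans h

theorem tmul_add (x y z : A) : tmul x (y + z) = tmul x y + tmul x z := by
  have h := (PiTensorProduct.tprod ℂ (s := fun _ : Fin 2 => A)).map_update_add ![x, y] 1 y z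
  have h' := congrArg (incl A) h
  rw [map_add, tmul_eq_tprod, tmul_eq_tprod, tmul_eq_tprod] at h'
  exact h'

theorem add_tmul (x y z : A) : tmul (x + y) z = tmul x z + tmul y z := by
  have h := (PiTensorProduct.tprod ℂ (s := fun _ : Fin 2 => A)).map_update_add ![x, z] 0 x y
  have h' := congrArg (incl A) h
  rw [map_add, tmul_eq_tprod, tmul_eq_tprod, tmul_eq_tprod] at h'
  exact h'

theorem tmul_smul (c : ℂ) (x y : A) : tmul x (c • y) = c • tmul x y := by
  have h := (PiTensorProduct.tprod ℂ (s := fun _ : Fin 2 => A)).map_update_smul ![x, y] 1 c y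
  have h' := congrArg (incl A) h
  rw [map_smul, tmul_eq_tprod, tmul_eq_tprod] at h'
  exact h'

theorem smul_tmul (c : ℂ) (x y : A) : tmul (c • x) y = c • tmul x y := by
  have h := (PiTensorProduct.tprod ℂ (s := fun _ : Fin 2 => A)).map_update_smul ![x, y] 0 c x
  have h' := congrArg (incl A) h
  rw [map_smul, tmul_eq_tprod, tmul_eq_tprod] at h'
  exact h'

variable (A) in
/-- The canonical bounded bilinear map `(x, y) ↦ x ⊗ y`. -/
def tmulL : NHom A (NHom A (ProjTensor A)) :=
  LinearMap.mkContinuous₂ (LinearMap.mk₂ ℂ tmul add_tmul smul_tmul tmul_add tmul_smul) 1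
    fun x y => by rw [one_mul]; exact norm_tmul_le x y

theorem tmulL_apply (x y : A) : tmulL A x y = tmul x y := rfl

end ProjTensor

open ProjTensor

variable {A : Type u} [NonUnitalNormedRing A] [NormedSpace ℂ A] [IsScalarTower ℂ A A]
  [SMulCommClass ℂ A A]

/-- The left action on `A ⊗̂ A`: `a · (x ⊗ y) = (a x) ⊗ y`. -/
def tensorLeft (a : A) : NHom (ProjTensor A) (ProjTensor A) :=
  lift ((tmulL A).comp (ContinuousLinearMap.mul ℂ A a))

/-- The right action on `A ⊗̂ A`: `(x ⊗ y) · a = x ⊗ (y a)`. -/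
def tensorRight (a : A) : NHom (ProjTensor A) (ProjTensor A) :=
  lift (((ContinuousLinearMap.compL ℂ A A (ProjTensor A)).flip
    ((ContinuousLinearMap.mul ℂ A).flip a)).comp (tmulL A))

theorem tensorLeft_tmul (a x y : A) : tensorLeft a (tmul x y) = tmul (a * x) y := lift_tmul _ x y

theorem tensorRight_tmul (a x y : A) : tensorRight a (tmul x y) = tmul x (y * a) := lift_tmul _ x y

theorem tensorLeft_mul (a b : A) : tensorLeft (a * b) = (tensorLeft a).comp (tensorLeft b) :=
  hom_ext fun x y => by
    rw [ContinuousLinearMap.comp_apply, tensorLeft_tmul, tensorLeft_tmul, tensorLeft_tmul,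
      mul_assoc]

theorem tensorRight_mul (a b : A) : tensorRight (a * b) = (tensorRight b).comp (tensorRight a) :=
  hom_ext fun x y => by
    rw [ContinuousLinearMap.comp_apply, tensorRight_tmul, tensorRight_tmul, tensorRight_tmul,
      mul_assoc]

theorem tensorLeft_tensorRight (a b : A) :
    (tensorLeft a).comp (tensorRight b) = (tensorRight b).comp (tensorLeft a) :=
  hom_ext fun x y => by
    rw [ContinuousLinearMap.comp_apply, ContinuousLinearMap.comp_apply, tensorLeft_tmul,
      tensorRight_tmul, tensorRight_tmul, tensorLeft_tmul]

variable (A) in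
/-- The product morphism `π : A ⊗̂ A → A`, `x ⊗ y ↦ x y`. -/
def prodMap [CompleteSpace A] : NHom (ProjTensor A) A := lift (ContinuousLinearMap.mul ℂ A)

theorem prodMap_tmul [CompleteSpace A] (x y : A) : prodMap A (tmul x y) = x * y := lift_tmul _ x y

theorem prodMap_tensorLeft [CompleteSpace A] (a : A) :
    (prodMap A).comp (tensorLeft a) = (ContinuousLinearMap.mul ℂ A a).comp (prodMap A) :=
  hom_ext fun x y => by
    rw [ContinuousLinearMap.comp_apply, ContinuousLinearMap.comp_apply, tensorLeft_tmul,
      prodMap_tmul, prodMap_tmul, ContinuousLinearMap.mul_apply', mul_assoc]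

theorem prodMap_tensorRight [CompleteSpace A] (a : A) :
    (prodMap A).comp (tensorRight a) = ((ContinuousLinearMap.mul ℂ A).flip a).comp (prodMap A) :=
  hom_ext fun x y => by
    rw [ContinuousLinearMap.comp_apply, ContinuousLinearMap.comp_apply, tensorRight_tmul,
      prodMap_tmul, prodMap_tmul, ContinuousLinearMap.flip_apply, ContinuousLinearMap.mul_apply',
      mul_assoc]

/-- The left action on `(A ⊗̂ A)*`: `(a · T)(z) = T (z · a)`. -/
def dualLeft (a : A) : NHom (NDual (ProjTensor A)) (NDual (ProjTensor A)) :=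
  (ContinuousLinearMap.compL ℂ (ProjTensor A) (ProjTensor A) ℂ).flip (tensorRight a)

/-- The right action on `(A ⊗̂ A)*`: `(T · a)(z) = T (a · z)`. -/
def dualRight (a : A) : NHom (NDual (ProjTensor A)) (NDual (ProjTensor A)) :=
  (ContinuousLinearMap.compL ℂ (ProjTensor A) (ProjTensor A) ℂ).flip (tensorLeft a)

theorem dualLeft_apply (a : A) (T : NDual (ProjTensor A)) (z : ProjTensor A) :
    dualLeft a T z = T (tensorRight a z) := rfl

theorem dualRight_apply (a : A) (T : NDual (ProjTensor A)) (z : ProjTensor A) :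
    dualRight a T z = T (tensorLeft a z) := rfl

theorem dualLeft_mul (a b : A) (T : NDual (ProjTensor A)) :
    dualLeft (a * b) T = dualLeft a (dualLeft b T) := by
  ext z
  rw [dualLeft_apply, tensorRight_mul]
  rfl

theorem dualRight_mul (a b : A) (T : NDual (ProjTensor A)) :
    dualRight (a * b) T = dualRight b (dualRight a T) := by
  ext z
  rw [dualRight_apply, tensorLeft_mul]
  rfl

theorem dualLeft_dualRight (a b : A) (T : NDual (ProjTensor A)) :
    dualLeft a (dualRight b T) = dualRight b (dualLeft a T) := by
  ext z
  change T ((tensorLeft b).comp (tensorRight a) z) = T ((tensorRight a).comp (tensorLeft b) z)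
  rw [tensorLeft_tensorRight]

end ProjTensorAlgebra

/-! ### `σwc((A ⊗̂ A)*)`, `π_σwc` and approximate Connes-biprojectivity -/

section ConnesBiprojective

variable (A : Type u) [NonUnitalNormedRing A] [NormedSpace ℂ A] [IsScalarTower ℂ A A]
  [SMulCommClass ℂ A A] [DualBanachAlgebra A]

/-- The predual `A_*` of a dual Banach algebra. -/
abbrev Predual : Submodule ℂ (NDual A) := DualBanachAlgebra.predual

/-- The weak* topology `σ(A, A_*)`. -/
@[reducible] def wkStarTopology : TopologicalSpace A :=
  TopologicalSpace.induced (fun (a : A) (f : Predual A) => (f : NDual A) a) Pi.topologicalSpace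

/-- The isometric identification `A = (A_*)*`. -/
def predualEquiv : A ≃ₗᵢ[ℂ] NDual (Predual A) :=
  LinearIsometryEquiv.ofSurjective
    { (evalOn (Predual A)).toLinearMap with norm_map' := DualBanachAlgebra.norm_evalOn }
    DualBanachAlgebra.evalOn_surjective

theorem predualEquiv_apply (a : A) (f : Predual A) : predualEquiv A a f = (f : NDual A) a := rfl

variable {A}

theorem wkStar_continuous_predual {f : NDual A} (hf : f ∈ Predual A) :
    @Continuous A ℂ (wkStarTopology A) _ (fun a => f a) := by
  let _ := wkStarTopology A
  have h : Continuous (fun (a : A) (f : Predual A) => (f : NDual A) a) := continuous_induced_dom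
  exact (continuous_apply (⟨f, hf⟩ : Predual A)).comp h

theorem wkStar_continuous_iff {X : Type v} (t : TopologicalSpace X) (g : X → A) :
    @Continuous X A t (wkStarTopology A) g ↔ ∀ f ∈ Predual A, Continuous fun x => f (g x) := by
  let _ := wkStarTopology A
  rw [continuous_induced_rng, continuous_pi_iff]
  exact ⟨fun h f hf => h ⟨f, hf⟩, fun h f => h f.1 f.2⟩

theorem wkStar_continuous_mulLeft (b : A) :
    @Continuous A A (wkStarTopology A) (wkStarTopology A) (fun a => b * a) :=
  (wkStar_continuous_iff _ _).2 fun f hf =>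
    wkStar_continuous_predual (DualBanachAlgebra.rightOrbit_mem f hf b)

theorem wkStar_continuous_mulRight (b : A) :
    @Continuous A A (wkStarTopology A) (wkStarTopology A) (fun a => a * b) :=
  (wkStar_continuous_iff _ _).2 fun f hf =>
    wkStar_continuous_predual (DualBanachAlgebra.leftOrbit_mem f hf b)

/-- Continuity from the weak* topology of `A` to the weak topology of a normed space. -/
def IsWkStarWkContinuous {E : Type v} [NormedAddCommGroup E] [NormedSpace ℂ E] (g : A → E) :
    Prop :=
  @Continuous A (WeakSpace ℂ E) (wkStarTopology A) _ (fun a => toWeakSpace ℂ E (g a))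

theorem isWkStarWkContinuous_iff {E : Type v} [NormedAddCommGroup E] [NormedSpace ℂ E]
    (g : A → E) : IsWkStarWkContinuous g ↔
      ∀ Φ : NDual E, @Continuous A ℂ (wkStarTopology A) _ (fun a => Φ (g a)) := by
  let _ := wkStarTopology A
  constructor
  · intro h Φ
    exact (WeakBilin.eval_continuous (topDualPairing ℂ E).flip Φ).comp h
  · intro h
    exact WeakBilin.continuous_of_continuous_eval _ h

variable (A) in
/-- `σwc((A ⊗̂ A)*)`: the functionals `T` for which `a ↦ a · T` and `a ↦ T · a` are
weak*-weakly continuous. -/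
def sigmaWC : Submodule ℂ (NDual (ProjTensor A)) where
  carrier := {T | IsWkStarWkContinuous (fun a : A => dualLeft a T) ∧
    IsWkStarWkContinuous (fun a : A => dualRight a T)}
  zero_mem' := by
    simp only [Set.mem_ofPred_eq, isWkStarWkContinuous_iff, map_zero]
    exact ⟨fun _ => @continuous_const _ _ (wkStarTopology A) _ _,
      fun _ => @continuous_const _ _ (wkStarTopology A) _ _⟩
  add_mem' {S T} hS hT := by
    simp only [Set.mem_ofPred_eq, isWkStarWkContinuous_iff, map_add] at hS hT ⊢
    let _ := wkStarTopology A
    exact ⟨fun Φ => (hS.1 Φ).add (hT.1 Φ), fun Φ => (hS.2 Φ).add (hT.2 Φ)⟩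
  smul_mem' c T hT := by
    simp only [Set.mem_ofPred_eq, isWkStarWkContinuous_iff, map_smul] at hT ⊢
    let _ := wkStarTopology A
    exact ⟨fun Φ => (hT.1 Φ).const_smul c, fun Φ => (hT.2 Φ).const_smul c⟩

theorem mem_sigmaWC_iff (T : NDual (ProjTensor A)) : T ∈ sigmaWC A ↔
    ∀ Φ : NDual (NDual (ProjTensor A)),
      @Continuous A ℂ (wkStarTopology A) _ (fun a => Φ (dualLeft a T)) ∧
      @Continuous A ℂ (wkStarTopology A) _ (fun a => Φ (dualRight a T)) := by
  change IsWkStarWkContinuous _ ∧ IsWkStarWkContinuous _ ↔ _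
  rw [isWkStarWkContinuous_iff, isWkStarWkContinuous_iff]
  exact ⟨fun h Φ => ⟨h.1 Φ, h.2 Φ⟩, fun h => ⟨fun Φ => (h Φ).1, fun Φ => (h Φ).2⟩⟩

theorem dualLeft_mem_sigmaWC (b : A) {T : NDual (ProjTensor A)} (hT : T ∈ sigmaWC A) :
    dualLeft b T ∈ sigmaWC A := by
  rw [mem_sigmaWC_iff] at hT ⊢
  let _ := wkStarTopology A
  intro Φ
  constructor
  · have h := (hT Φ).1.comp (wkStar_continuous_mulRight b)
    refine h.congr fun a => ?_
    change Φ (dualLeft (a * b) T) = _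
    rw [dualLeft_mul]
  · refine (hT (Φ.comp (dualLeft b))).2.congr fun a => ?_
    rw [← dualLeft_dualRight]
    rfl

theorem dualRight_mem_sigmaWC (b : A) {T : NDual (ProjTensor A)} (hT : T ∈ sigmaWC A) :
    dualRight b T ∈ sigmaWC A := by
  rw [mem_sigmaWC_iff] at hT ⊢
  let _ := wkStarTopology A
  intro Φ
  constructor
  · refine (hT (Φ.comp (dualRight b))).1.congr fun a => ?_
    rw [dualLeft_dualRight]
    rfl
  · have h := (hT Φ).2.comp (wkStar_continuous_mulLeft b)
    refine h.congr fun a => ?_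
    change Φ (dualRight (b * a) T) = _
    rw [dualRight_mul]

/-- `T ↦ a · T` on `σwc((A ⊗̂ A)*)`. -/
def sigmaLeft (a : A) : NHom (sigmaWC A) (sigmaWC A) :=
  ((dualLeft a).comp (sigmaWC A).subtypeL).codRestrict (sigmaWC A)
    fun T => dualLeft_mem_sigmaWC a T.2

/-- `T ↦ T · a` on `σwc((A ⊗̂ A)*)`. -/
def sigmaRight (a : A) : NHom (sigmaWC A) (sigmaWC A) :=
  ((dualRight a).comp (sigmaWC A).subtypeL).codRestrict (sigmaWC A)
    fun T => dualRight_mem_sigmaWC a T.2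

/-- The left action on `(σwc((A ⊗̂ A)*))*`: `(a · M)(T) = M (T · a)`. -/
def sigmaDualLeft (a : A) (M : NDual (sigmaWC A)) : NDual (sigmaWC A) := M.comp (sigmaRight a)

/-- The right action on `(σwc((A ⊗̂ A)*))*`: `(M · a)(T) = M (a · T)`. -/
def sigmaDualRight (M : NDual (sigmaWC A)) (a : A) : NDual (sigmaWC A) := M.comp (sigmaLeft a)

variable [CompleteSpace A]

/-- The adjoint of `π` maps the predual into `σwc((A ⊗̂ A)*)`. -/
theorem comp_prodMap_mem_sigmaWC {f : NDual A} (hf : f ∈ Predual A) :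
    f.comp (prodMap A) ∈ sigmaWC A := by
  rw [mem_sigmaWC_iff]
  intro Φ
  obtain ⟨c, hc⟩ := DualBanachAlgebra.evalOn_surjective (A := A)
    (Φ.comp (((ContinuousLinearMap.compL ℂ (ProjTensor A) A ℂ).flip (prodMap A)).comp
      (Predual A).subtypeL))
  have hc' : ∀ g (hg : g ∈ Predual A), Φ (g.comp (prodMap A)) = g c := fun g hg =>
    (congrArg (fun F => F ⟨g, hg⟩) hc).symm
  have e1 : (fun a => Φ (dualLeft a (f.comp (prodMap A)))) = fun a => rightOrbit f c a := by
    funext a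
    have h : dualLeft a (f.comp (prodMap A)) = (leftOrbit f a).comp (prodMap A) := by
      change (f.comp (prodMap A)).comp (tensorRight a) = _
      rw [ContinuousLinearMap.comp_assoc, prodMap_tensorRight]
      rfl
    rw [h, hc' _ (DualBanachAlgebra.leftOrbit_mem f hf a)]
    rfl
  have e2 : (fun a => Φ (dualRight a (f.comp (prodMap A)))) = fun a => leftOrbit f c a := by
    funext a
    have h : dualRight a (f.comp (prodMap A)) = (rightOrbit f a).comp (prodMap A) := by
      change (f.comp (prodMap A)).comp (tensorLeft a) = _
      rw [ContinuousLinearMap.comp_assoc, prodMap_tensorLeft]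
      rfl
    rw [h, hc' _ (DualBanachAlgebra.rightOrbit_mem f hf a)]
    rfl
  rw [e1, e2]
  exact ⟨wkStar_continuous_predual (DualBanachAlgebra.rightOrbit_mem f hf c),
    wkStar_continuous_predual (DualBanachAlgebra.leftOrbit_mem f hf c)⟩

variable (A) in
/-- The restriction `A_* → σwc((A ⊗̂ A)*)`, `f ↦ f ∘ π`, of the adjoint of `π`. -/
def prodAdjoint : NHom (Predual A) (sigmaWC A) :=
  (((ContinuousLinearMap.compL ℂ (ProjTensor A) A ℂ).flip (prodMap A)).comp
    (Predual A).subtypeL).codRestrict (sigmaWC A) fun f => comp_prodMap_mem_sigmaWC f.2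

/-- `π_σwc : (σwc((A ⊗̂ A)*))* → (A_*)* = A`, the adjoint of `f ↦ f ∘ π`. -/
def prodSigmaWC (M : NDual (sigmaWC A)) : A := (predualEquiv A).symm (M.comp (prodAdjoint A))

theorem apply_prodSigmaWC (M : NDual (sigmaWC A)) (f : Predual A) :
    (f : NDual A) (prodSigmaWC M) = M (prodAdjoint A f) := by
  rw [← predualEquiv_apply, prodSigmaWC, LinearIsometryEquiv.apply_symm_apply]
  rfl

/-- `A`-bimodule morphisms `A → (σwc((A ⊗̂ A)*))*`. -/
structure IsBimoduleMorphism (ρ : NHom A (NDual (sigmaWC A))) : Prop where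
  map_left : ∀ a b : A, ρ (a * b) = sigmaDualLeft a (ρ b)
  map_right : ∀ a b : A, ρ (a * b) = sigmaDualRight (ρ a) b

variable (A) in
/-- Approximate Connes-biprojectivity: there is a net `(ρ i)` of continuous `A`-bimodule morphisms
`A → (σwc((A ⊗̂ A)*))*` such that `π_σwc (ρ i a) → a` in norm for every `a`. The index sets of the
nets range over an arbitrary universe. -/
def ApproximatelyConnesBiprojective : Prop :=
  ∃ (ι : Type v) (_ : Preorder ι) (_ : Nonempty ι) (_ : IsDirectedOrder ι)
    (ρ : ι → NHom A (NDual (sigmaWC A))),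
    (∀ i, IsBimoduleMorphism (ρ i)) ∧
      ∀ a : A, Tendsto (fun i => prodSigmaWC (ρ i a)) atTop (𝓝 a)

end ConnesBiprojective

/-! ### The triangular Banach algebra `Tri(A, A, A)` -/

/-- The triangular algebra `Tri(A, A, A)`, consisting of the matrices with rows `(a, x)`
and `(0, b)`. -/
@[ext] structure Tri (A : Type u) : Type u where
  a : A
  x : A
  b : A

namespace Tri

section Basic

variable {A : Type u} [NonUnitalNormedRing A]

/-- The underlying triple of entries. -/
def equivProd : Tri A ≃ A × A × A where
  toFun t := (t.a, t.x, t.b)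
  invFun p := ⟨p.1, p.2.1, p.2.2⟩
  left_inv _ := rfl
  right_inv _ := rfl

instance : AddCommGroup (Tri A) := equivProd.addCommGroup

@[simp] theorem add_a (s t : Tri A) : (s + t).a = s.a + t.a := rfl
@[simp] theorem add_x (s t : Tri A) : (s + t).x = s.x + t.x := rfl
@[simp] theorem add_b (s t : Tri A) : (s + t).b = s.b + t.b := rfl
@[simp] theorem zero_a : (0 : Tri A).a = 0 := rfl
@[simp] theorem zero_x : (0 : Tri A).x = 0 := rfl
@[simp] theorem zero_b : (0 : Tri A).b = 0 := rfl

/-- The norm is the sum of the norms of the entries. -/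
instance : Norm (Tri A) := ⟨fun t => ‖t.a‖ + ‖t.x‖ + ‖t.b‖⟩

theorem norm_def (t : Tri A) : ‖t‖ = ‖t.a‖ + ‖t.x‖ + ‖t.b‖ := rfl

/-- Multiplication of upper triangular matrices. -/
instance : Mul (Tri A) := ⟨fun s t => ⟨s.a * t.a, s.a * t.x + s.x * t.b, s.b * t.b⟩⟩

@[simp] theorem mul_a (s t : Tri A) : (s * t).a = s.a * t.a := rfl
@[simp] theorem mul_x (s t : Tri A) : (s * t).x = s.a * t.x + s.x * t.b := rfl
@[simp] theorem mul_b (s t : Tri A) : (s * t).b = s.b * t.b := rfl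

variable [NormedSpace ℂ A]

instance : Module ℂ (Tri A) := equivProd.module ℂ

@[simp] theorem smul_a (c : ℂ) (t : Tri A) : (c • t).a = c • t.a := rfl
@[simp] theorem smul_x (c : ℂ) (t : Tri A) : (c • t).x = c • t.x := rfl
@[simp] theorem smul_b (c : ℂ) (t : Tri A) : (c • t).b = c • t.b := rfl

theorem core : NormedSpace.Core ℂ (Tri A) where
  norm_nonneg t := by rw [norm_def]; positivity
  norm_smul c t := by simp only [norm_def, smul_a, smul_x, smul_b, norm_smul]; ring
  norm_triangle s t := by
    simp only [norm_def, add_a, add_x, add_b]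
    linarith [norm_add_le s.a t.a, norm_add_le s.x t.x, norm_add_le s.b t.b]
  norm_eq_zero_iff t := by
    rw [norm_def]
    constructor
    · intro h
      have h1 := norm_nonneg t.a
      have h2 := norm_nonneg t.x
      have h3 := norm_nonneg t.b
      ext
      · exact norm_eq_zero.1 (by linarith)
      · exact norm_eq_zero.1 (by linarith)
      · exact norm_eq_zero.1 (by linarith)
    · rintro rfl
      simp

instance : NormedAddCommGroup (Tri A) := NormedAddCommGroup.ofCore core

instance : NormedSpace ℂ (Tri A) := NormedSpace.ofCore core

instance : NonUnitalRing (Tri A) where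
  left_distrib r s t := by
    ext <;> simp only [mul_a, mul_x, mul_b, add_a, add_x, add_b, mul_add]
    abel
  right_distrib r s t := by
    ext <;> simp only [mul_a, mul_x, mul_b, add_a, add_x, add_b, add_mul]
    abel
  zero_mul t := by ext <;> simp
  mul_zero t := by ext <;> simp
  mul_assoc r s t := by
    ext <;> simp only [mul_a, mul_x, mul_b, mul_add, add_mul, mul_assoc]
    abel

instance : NonUnitalNormedRing (Tri A) where
  dist_eq s t := NormedAddGroup.dist_eq s t
  norm_mul_le s t := by
    simp only [norm_def, mul_a, mul_x, mul_b]
    have h1 := norm_mul_le s.a t.a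
    have h2 := norm_mul_le s.a t.x
    have h3 := norm_mul_le s.x t.b
    have h4 := norm_mul_le s.b t.b
    have h5 := norm_add_le (s.a * t.x) (s.x * t.b)
    have p1 := mul_nonneg (norm_nonneg s.a) (norm_nonneg t.b)
    have p2 := mul_nonneg (norm_nonneg s.x) (norm_nonneg t.a)
    have p3 := mul_nonneg (norm_nonneg s.x) (norm_nonneg t.x)
    have p4 := mul_nonneg (norm_nonneg s.b) (norm_nonneg t.a)
    have p5 := mul_nonneg (norm_nonneg s.b) (norm_nonneg t.x)
    nlinarith

instance [IsScalarTower ℂ A A] : IsScalarTower ℂ (Tri A) (Tri A) :=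
  ⟨fun c s t => by
    ext <;> simp only [smul_eq_mul, smul_a, smul_x, smul_b, mul_a, mul_x, mul_b, smul_mul_assoc,
      smul_add]⟩

instance [SMulCommClass ℂ A A] : SMulCommClass ℂ (Tri A) (Tri A) :=
  ⟨fun c s t => by
    ext <;> simp only [smul_eq_mul, smul_a, smul_x, smul_b, mul_a, mul_x, mul_b, mul_smul_comm,
      smul_add]⟩

variable (A) in
/-- The coordinate `t ↦ t.a`. -/
def prA : NHom (Tri A) A :=
  LinearMap.mkContinuous ⟨⟨fun t => t.a, fun _ _ => rfl⟩, fun _ _ => rfl⟩ 1 fun t => by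
    rw [one_mul, norm_def]
    exact (le_add_of_nonneg_right (norm_nonneg _)).trans (le_add_of_nonneg_right (norm_nonneg _))

variable (A) in
/-- The coordinate `t ↦ t.x`. -/
def prX : NHom (Tri A) A :=
  LinearMap.mkContinuous ⟨⟨fun t => t.x, fun _ _ => rfl⟩, fun _ _ => rfl⟩ 1 fun t => by
    rw [one_mul, norm_def]
    exact (le_add_of_nonneg_left (norm_nonneg _)).trans (le_add_of_nonneg_right (norm_nonneg _))

variable (A) in
/-- The coordinate `t ↦ t.b`. -/
def prB : NHom (Tri A) A :=
  LinearMap.mkContinuous ⟨⟨fun t => t.b, fun _ _ => rfl⟩, fun _ _ => rfl⟩ 1 fun t => by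
    rw [one_mul, norm_def]
    exact le_add_of_nonneg_left (add_nonneg (norm_nonneg _) (norm_nonneg _))

variable (A) in
/-- The inclusion `a ↦ ⟨a, 0, 0⟩`. -/
def inA : NHom A (Tri A) :=
  LinearMap.mkContinuous ⟨⟨fun a => ⟨a, 0, 0⟩, fun _ _ => by ext <;> simp⟩,
    fun _ _ => by ext <;> simp⟩ 1 fun a => by
      rw [one_mul, norm_def]; simp

variable (A) in
/-- The inclusion `x ↦ ⟨0, x, 0⟩`. -/
def inX : NHom A (Tri A) :=
  LinearMap.mkContinuous ⟨⟨fun x => ⟨0, x, 0⟩, fun _ _ => by ext <;> simp⟩,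
    fun _ _ => by ext <;> simp⟩ 1 fun a => by
      rw [one_mul, norm_def]; simp

variable (A) in
/-- The inclusion `b ↦ ⟨0, 0, b⟩`. -/
def inB : NHom A (Tri A) :=
  LinearMap.mkContinuous ⟨⟨fun b => ⟨0, 0, b⟩, fun _ _ => by ext <;> simp⟩,
    fun _ _ => by ext <;> simp⟩ 1 fun a => by
      rw [one_mul, norm_def]; simp

theorem inA_apply (a : A) : inA A a = ⟨a, 0, 0⟩ := rfl
theorem inX_apply (a : A) : inX A a = ⟨0, a, 0⟩ := rfl
theorem inB_apply (a : A) : inB A a = ⟨0, 0, a⟩ := rfl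

theorem eq_sum (t : Tri A) : t = inA A t.a + inX A t.x + inB A t.b := by
  ext <;> simp [inA_apply, inX_apply, inB_apply]

theorem apply_eq (F : NDual (Tri A)) (t : Tri A) :
    F t = F (inA A t.a) + F (inX A t.x) + F (inB A t.b) := by
  conv_lhs => rw [eq_sum t]
  rw [map_add, map_add]

/-- The functional `t ↦ f (t.a) + g (t.x) + h (t.b)`. -/
def functional (f g h : NDual A) : NDual (Tri A) :=
  f.comp (prA A) + g.comp (prX A) + h.comp (prB A)

theorem functional_apply (f g h : NDual A) (t : Tri A) :
    functional f g h t = f t.a + g t.x + h t.b := rfl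

theorem eq_functional (F : NDual (Tri A)) :
    F = functional (F.comp (inA A)) (F.comp (inX A)) (F.comp (inB A)) :=
  ContinuousLinearMap.ext fun t => apply_eq F t

theorem norm_functional_le (f g h : NDual A) {C : ℝ} (hC : 0 ≤ C) (hf : ‖f‖ ≤ C) (hg : ‖g‖ ≤ C)
    (hh : ‖h‖ ≤ C) : ‖functional f g h‖ ≤ C := by
  refine ContinuousLinearMap.opNorm_le_bound _ hC fun t => ?_
  rw [functional_apply, norm_def, mul_add, mul_add]
  refine (norm_add_le _ _).trans (add_le_add ((norm_add_le _ _).trans (add_le_add ?_ ?_)) ?_)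
  · exact f.le_of_opNorm_le hf _
  · exact g.le_of_opNorm_le hg _
  · exact h.le_of_opNorm_le hh _

/-- The functionals `t ↦ f (t.a) + g (t.x) + h (t.b)` with `f`, `g`, `h` in `P`. Their operator
norm is `max ‖f‖ ‖g‖ ‖h‖`, so that this is the space `P ⊕_∞ P ⊕_∞ P`. -/
def sumPredual (P : Submodule ℂ (NDual A)) : Submodule ℂ (NDual (Tri A)) where
  carrier := {F | F.comp (inA A) ∈ P ∧ F.comp (inX A) ∈ P ∧ F.comp (inB A) ∈ P}
  zero_mem' := ⟨P.zero_mem, P.zero_mem, P.zero_mem⟩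
  add_mem' h k := ⟨P.add_mem h.1 k.1, P.add_mem h.2.1 k.2.1, P.add_mem h.2.2 k.2.2⟩
  smul_mem' c _ h := ⟨P.smul_mem c h.1, P.smul_mem c h.2.1, P.smul_mem c h.2.2⟩

theorem functional_comp_inA (f g h : NDual A) : (functional f g h).comp (inA A) = f :=
  ContinuousLinearMap.ext fun y => by
    rw [ContinuousLinearMap.comp_apply, functional_apply, inA_apply]
    simp

theorem functional_comp_inX (f g h : NDual A) : (functional f g h).comp (inX A) = g :=
  ContinuousLinearMap.ext fun y => by
    rw [ContinuousLinearMap.comp_apply, functional_apply, inX_apply]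
    simp

theorem functional_comp_inB (f g h : NDual A) : (functional f g h).comp (inB A) = h :=
  ContinuousLinearMap.ext fun y => by
    rw [ContinuousLinearMap.comp_apply, functional_apply, inB_apply]
    simp

theorem mem_sumPredual_iff (P : Submodule ℂ (NDual A)) (F : NDual (Tri A)) :
    F ∈ sumPredual P ↔ ∃ f ∈ P, ∃ g ∈ P, ∃ h ∈ P, F = functional f g h := by
  constructor
  · exact fun H => ⟨_, H.1, _, H.2.1, _, H.2.2, eq_functional F⟩
  · rintro ⟨f, hf, g, hg, h, hh, rfl⟩
    refine ⟨?_, ?_, ?_⟩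
    · rw [functional_comp_inA]; exact hf
    · rw [functional_comp_inX]; exact hg
    · rw [functional_comp_inB]; exact hh

theorem functional_mem {P : Submodule ℂ (NDual A)} {f g h : NDual A} (hf : f ∈ P) (hg : g ∈ P)
    (hh : h ∈ P) : functional f g h ∈ sumPredual P :=
  (mem_sumPredual_iff P _).2 ⟨f, hf, g, hg, h, hh, rfl⟩

theorem comp_prA_mem {P : Submodule ℂ (NDual A)} {f : NDual A} (hf : f ∈ P) :
    f.comp (prA A) ∈ sumPredual P := by
  have h : functional f 0 0 = f.comp (prA A) := ContinuousLinearMap.ext fun t => by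
    rw [functional_apply, zero_apply, zero_apply, add_zero, add_zero]; rfl
  exact h ▸ functional_mem hf P.zero_mem P.zero_mem

theorem comp_prX_mem {P : Submodule ℂ (NDual A)} {f : NDual A} (hf : f ∈ P) :
    f.comp (prX A) ∈ sumPredual P := by
  have h : functional 0 f 0 = f.comp (prX A) := ContinuousLinearMap.ext fun t => by
    rw [functional_apply, zero_apply, zero_apply, zero_add, add_zero]; rfl
  exact h ▸ functional_mem P.zero_mem hf P.zero_mem

theorem comp_prB_mem {P : Submodule ℂ (NDual A)} {f : NDual A} (hf : f ∈ P) :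
    f.comp (prB A) ∈ sumPredual P := by
  have h : functional 0 0 f = f.comp (prB A) := ContinuousLinearMap.ext fun t => by
    rw [functional_apply, zero_apply, zero_apply, zero_add, zero_add]; rfl
  exact h ▸ functional_mem P.zero_mem P.zero_mem hf

end Basic

section Dual

variable {A : Type u} [NonUnitalNormedRing A] [NormedSpace ℂ A] [IsScalarTower ℂ A A]
  [SMulCommClass ℂ A A]

theorem leftOrbit_functional (f g h : NDual A) (t : Tri A) :
    leftOrbit (functional f g h) t =
      functional (leftOrbit f t.a + leftOrbit g t.x) (leftOrbit g t.b) (leftOrbit h t.b) := by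
  refine ContinuousLinearMap.ext fun s => ?_
  rw [leftOrbit_apply, functional_apply, functional_apply, mul_a, mul_x, mul_b, map_add,
    add_apply]
  simp only [leftOrbit_apply]
  ring

theorem rightOrbit_functional (f g h : NDual A) (t : Tri A) :
    rightOrbit (functional f g h) t =
      functional (rightOrbit f t.a) (rightOrbit g t.a) (rightOrbit g t.x + rightOrbit h t.b) := by
  refine ContinuousLinearMap.ext fun s => ?_
  rw [rightOrbit_apply, functional_apply, functional_apply, mul_a, mul_x, mul_b, map_add,
    add_apply]
  simp only [rightOrbit_apply]
  ring

theorem norm_le_of_re_le [DualBanachAlgebra A] (a : A) (c : ℝ)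
    (h : ∀ f ∈ Predual A, ‖f‖ ≤ 1 → (f a).re ≤ c) : ‖a‖ ≤ c := by
  rw [← DualBanachAlgebra.norm_evalOn a]
  refine le_of_forall_pos_le_add fun ε hε => ?_
  exact norm_le_of_re_lt (evalOn (Predual A) a) (c + ε) fun f hf =>
    (h f f.2 hf).trans_lt (lt_add_of_pos_right c hε)

/-- If `A` is a dual Banach algebra with predual `A_*`, then `Tri(A, A, A)` is a dual Banach
algebra with predual `A_* ⊕_∞ A_* ⊕_∞ A_*`. -/
instance [DualBanachAlgebra A] : DualBanachAlgebra (Tri A) where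
  predual := sumPredual (Predual A)
  isClosed_predual := by
    have hc := DualBanachAlgebra.isClosed_predual (A := A)
    have c1 : Continuous fun F : NDual (Tri A) => F.comp (inA A) :=
      continuous_id.clm_comp continuous_const
    have c2 : Continuous fun F : NDual (Tri A) => F.comp (inX A) :=
      continuous_id.clm_comp continuous_const
    have c3 : Continuous fun F : NDual (Tri A) => F.comp (inB A) :=
      continuous_id.clm_comp continuous_const
    exact (hc.preimage c1).inter ((hc.preimage c2).inter (hc.preimage c3))
  leftOrbit_mem F hF t := by
    obtain ⟨f, hf, g, hg, h, hh, rfl⟩ := (mem_sumPredual_iff _ _).1 hF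
    rw [leftOrbit_functional]
    exact functional_mem
      (Submodule.add_mem _ (DualBanachAlgebra.leftOrbit_mem f hf _)
        (DualBanachAlgebra.leftOrbit_mem g hg _))
      (DualBanachAlgebra.leftOrbit_mem g hg _) (DualBanachAlgebra.leftOrbit_mem h hh _)
  rightOrbit_mem F hF t := by
    obtain ⟨f, hf, g, hg, h, hh, rfl⟩ := (mem_sumPredual_iff _ _).1 hF
    rw [rightOrbit_functional]
    exact functional_mem (DualBanachAlgebra.rightOrbit_mem f hf _)
      (DualBanachAlgebra.rightOrbit_mem g hg _)
      (Submodule.add_mem _ (DualBanachAlgebra.rightOrbit_mem g hg _)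
        (DualBanachAlgebra.rightOrbit_mem h hh _))
  norm_evalOn t := by
    refine le_antisymm ?_ ?_
    · refine ContinuousLinearMap.opNorm_le_bound _ (norm_nonneg t) fun F => ?_
      rw [evalOn_apply, mul_comm]
      exact (F : NDual (Tri A)).le_opNorm t
    · have key : ∀ f ∈ Predual A, ‖f‖ ≤ 1 → ∀ g ∈ Predual A, ‖g‖ ≤ 1 → ∀ h ∈ Predual A, ‖h‖ ≤ 1 →
          (f t.a).re + (g t.x).re + (h t.b).re ≤ ‖evalOn (sumPredual (Predual A)) t‖ := by
        intro f hf hf1 g hg hg1 h hh hh1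
        let F : sumPredual (Predual A) := ⟨functional f g h, functional_mem hf hg hh⟩
        have hF : ‖F‖ ≤ 1 := norm_functional_le f g h zero_le_one hf1 hg1 hh1
        have h1 : (functional f g h t).re ≤ ‖functional f g h t‖ := Complex.re_le_norm _
        have h2 : ‖functional f g h t‖ ≤ ‖evalOn (sumPredual (Predual A)) t‖ * ‖F‖ :=
          (evalOn (sumPredual (Predual A)) t).le_opNorm F
        rw [functional_apply, Complex.add_re, Complex.add_re] at h1
        exact h1.trans (h2.trans (mul_le_of_le_one_right (norm_nonneg _) hF))
      rw [norm_def]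
      have s3 : ‖t.b‖ ≤ ‖evalOn (sumPredual (Predual A)) t‖ - ‖t.a‖ - ‖t.x‖ := by
        refine norm_le_of_re_le _ _ fun h hh hh1 => ?_
        have s2 : ‖t.x‖ ≤ ‖evalOn (sumPredual (Predual A)) t‖ - ‖t.a‖ - (h t.b).re := by
          refine norm_le_of_re_le _ _ fun g hg hg1 => ?_
          have s1 : ‖t.a‖ ≤ ‖evalOn (sumPredual (Predual A)) t‖ - (g t.x).re - (h t.b).re := by
            refine norm_le_of_re_le _ _ fun f hf hf1 => ?_
            linarith [key f hf hf1 g hg hg1 h hh hh1]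
          linarith
        linarith
      linarith
  evalOn_surjective Φ := by
    let j1 : NHom (Predual A) (sumPredual (Predual A)) :=
      (((ContinuousLinearMap.compL ℂ (Tri A) A ℂ).flip (prA A)).comp
        (Predual A).subtypeL).codRestrict _ fun f => comp_prA_mem f.2
    let j2 : NHom (Predual A) (sumPredual (Predual A)) :=
      (((ContinuousLinearMap.compL ℂ (Tri A) A ℂ).flip (prX A)).comp
        (Predual A).subtypeL).codRestrict _ fun f => comp_prX_mem f.2
    let j3 : NHom (Predual A) (sumPredual (Predual A)) :=
      (((ContinuousLinearMap.compL ℂ (Tri A) A ℂ).flip (prB A)).comp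
        (Predual A).subtypeL).codRestrict _ fun f => comp_prB_mem f.2
    obtain ⟨c1, h1⟩ := DualBanachAlgebra.evalOn_surjective (A := A) (Φ.comp j1)
    obtain ⟨c2, h2⟩ := DualBanachAlgebra.evalOn_surjective (A := A) (Φ.comp j2)
    obtain ⟨c3, h3⟩ := DualBanachAlgebra.evalOn_surjective (A := A) (Φ.comp j3)
    refine ⟨⟨c1, c2, c3⟩, ContinuousLinearMap.ext ?_⟩
    rintro ⟨F, hF⟩
    obtain ⟨f, hf, g, hg, h, hh, rfl⟩ := (mem_sumPredual_iff _ _).1 hF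
    have e : (⟨functional f g h, hF⟩ : sumPredual (Predual A)) =
        j1 ⟨f, hf⟩ + j2 ⟨g, hg⟩ + j3 ⟨h, hh⟩ := Subtype.ext rfl
    have k1 : Φ (j1 ⟨f, hf⟩) = f c1 := (congrArg (fun G => G ⟨f, hf⟩) h1).symm
    have k2 : Φ (j2 ⟨g, hg⟩) = g c2 := (congrArg (fun G => G ⟨g, hg⟩) h2).symm
    have k3 : Φ (j3 ⟨h, hh⟩) = h c3 := (congrArg (fun G => G ⟨h, hh⟩) h3).symm
    rw [evalOn_apply, functional_apply, e, map_add, map_add, k1, k2, k3]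

/-- `Tri(A, A, A)` is complete, being a dual space. -/
instance [DualBanachAlgebra A] : CompleteSpace (Tri A) :=
  (predualEquiv (Tri A)).toIsometryEquiv.completeSpace

end Dual

end Tri

/-! ### The semigroup algebra `ℓ¹(S)` -/

section L1

/-- The Banach space `ℓ¹(S)` of absolutely summable complex functions on `S`. -/
def L1 (S : Type u) : Type u := lp (fun _ : S => ℂ) 1

namespace L1

variable {S : Type u}

instance : NormedAddCommGroup (L1 S) := inferInstanceAs (NormedAddCommGroup (lp (fun _ : S => ℂ) 1))

instance : NormedSpace ℂ (L1 S) := inferInstanceAs (NormedSpace ℂ (lp (fun _ : S => ℂ) 1))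

instance : CompleteSpace (L1 S) := inferInstanceAs (CompleteSpace (lp (fun _ : S => ℂ) 1))

/-- The value of `f` at a point. -/
def coeFn (f : L1 S) : S → ℂ := (show lp (fun _ : S => ℂ) 1 from f).1

instance : CoeFun (L1 S) fun _ => S → ℂ := ⟨coeFn⟩

theorem add_apply (f g : L1 S) (s : S) : (f + g) s = f s + g s := rfl

theorem smul_apply (c : ℂ) (f : L1 S) (s : S) : (c • f) s = c * f s := rfl

open Classical in
/-- The point mass `δ_s`. -/
def delta (s : S) : L1 S := lp.single (E := fun _ : S => ℂ) 1 s 1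

theorem delta_self (s : S) : delta s s = 1 := by
  classical
  exact Pi.single_eq_same (M := fun _ : S => ℂ) s 1

theorem delta_ne {s t : S} (h : t ≠ s) : delta s t = 0 := by
  classical
  exact Pi.single_eq_of_ne (M := fun _ : S => ℂ) h 1

theorem norm_delta (s : S) : ‖delta s‖ = 1 := by
  classical
  exact (lp.norm_single (E := fun _ : S => ℂ) (p := 1) zero_lt_one s 1).trans norm_one

theorem hasSum_norm (f : L1 S) : HasSum (fun s => ‖f s‖) ‖f‖ := by
  have h := lp.hasSum_norm (E := fun _ : S => ℂ) (p := 1) (by simp) f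
  simp only [ENNReal.toReal_one, Real.rpow_one] at h
  exact h

theorem hasSum_delta (f : L1 S) : HasSum (fun s => f s • delta s) f := by
  classical
  have h := lp.hasSum_single (E := fun _ : S => ℂ) (p := 1) ENNReal.one_ne_top f
  have e : (fun s => f s • delta s) = fun s => lp.single (E := fun _ : S => ℂ) 1 s (f s) := by
    funext s
    refine (lp.single_smul (E := fun _ : S => ℂ) 1 s (f s) (1 : ℂ)).symm.trans ?_
    rw [smul_eq_mul, mul_one]
  rw [e]
  exact h

variable {G : Type v} [NormedAddCommGroup G] [NormedSpace ℂ G]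

theorem hom_ext {T T' : NHom (L1 S) G} (h : ∀ s, T (delta s) = T' (delta s)) : T = T' := by
  refine ContinuousLinearMap.ext fun f => ?_
  have h1 := T.hasSum (hasSum_delta f)
  have h2 := T'.hasSum (hasSum_delta f)
  have h3 : (fun s => T (f s • delta s)) = fun s => T' (f s • delta s) := by
    funext s; rw [map_smul, map_smul, h]
  rw [h3] at h1
  exact h1.unique h2

section Mul

variable [Mul S]

theorem summable_norm_conv (f g : L1 S) :
    Summable fun p : S × S => ‖(f p.1 * g p.2) • delta (p.1 * p.2)‖ := by
  have h := (hasSum_norm f).summable.mul_of_nonneg (hasSum_norm g).summable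
    (fun _ => norm_nonneg _) (fun _ => norm_nonneg _)
  refine h.congr fun p => ?_
  rw [norm_smul, norm_delta, mul_one, norm_mul]

/-- Convolution: `f * g = ∑_{s,t} f(s) g(t) δ_{st}`, a norm convergent series in `ℓ¹(S)`. -/
instance : Mul (L1 S) := ⟨fun f g => ∑' p : S × S, (f p.1 * g p.2) • delta (p.1 * p.2)⟩

theorem hasSum_mul (f g : L1 S) :
    HasSum (fun p : S × S => (f p.1 * g p.2) • delta (p.1 * p.2)) (f * g) :=
  (summable_norm_conv f g).of_norm.hasSum

theorem norm_mul_le' (f g : L1 S) : ‖f * g‖ ≤ ‖f‖ * ‖g‖ := by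
  have hs := (hasSum_norm f).summable.mul_of_nonneg (hasSum_norm g).summable
    (fun _ => norm_nonneg _) (fun _ => norm_nonneg _)
  have h := (hasSum_norm f).mul (hasSum_norm g) hs
  refine tsum_of_norm_bounded h fun p => ?_
  rw [norm_smul, norm_delta, mul_one, norm_mul]

theorem add_mul' (f f' g : L1 S) : (f + f') * g = f * g + f' * g := by
  refine (hasSum_mul (f + f') g).unique ?_
  convert (hasSum_mul f g).add (hasSum_mul f' g) using 1
  funext p
  rw [add_apply, add_mul, add_smul]

theorem mul_add' (f g g' : L1 S) : f * (g + g') = f * g + f * g' := by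
  refine (hasSum_mul f (g + g')).unique ?_
  convert (hasSum_mul f g).add (hasSum_mul f g') using 1
  funext p
  rw [add_apply, mul_add, add_smul]

theorem smul_mul' (c : ℂ) (f g : L1 S) : (c • f) * g = c • (f * g) := by
  refine (hasSum_mul (c • f) g).unique ?_
  convert (hasSum_mul f g).const_smul c using 1
  funext p
  rw [smul_apply, mul_assoc, mul_smul]

theorem mul_smul' (c : ℂ) (f g : L1 S) : f * (c • g) = c • (f * g) := by
  refine (hasSum_mul f (c • g)).unique ?_
  convert (hasSum_mul f g).const_smul c using 1
  funext p
  rw [smul_apply, mul_left_comm, mul_smul]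

variable (S) in
/-- Convolution as a bounded bilinear map. -/
def mulL : NHom (L1 S) (NHom (L1 S) (L1 S)) :=
  LinearMap.mkContinuous₂ (LinearMap.mk₂ ℂ (fun f g : L1 S => f * g) add_mul' smul_mul' mul_add'
    mul_smul') 1 fun f g => by rw [one_mul]; exact norm_mul_le' f g

theorem mulL_apply (f g : L1 S) : mulL S f g = f * g := rfl

theorem delta_mul_delta (s t : S) : delta s * delta t = delta (s * t) := by
  have h : HasSum (fun p : S × S => (delta s p.1 * delta t p.2) • delta (p.1 * p.2))
      ((delta s s * delta t t) • delta (s * t)) := by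
    refine hasSum_single (s, t) fun p hp => ?_
    by_cases h1 : p.1 = s
    · have h2 : p.2 ≠ t := fun h2 => hp (Prod.ext h1 h2)
      rw [delta_ne h2, mul_zero, zero_smul]
    · rw [delta_ne h1, zero_mul, zero_smul]
  rw [delta_self, delta_self, mul_one, one_smul] at h
  exact (hasSum_mul _ _).unique h

end Mul

section Semigroup

variable [Semigroup S]

theorem mul_assoc' (f g h : L1 S) : f * g * h = f * (g * h) := by
  have e1 : (ContinuousLinearMap.compL ℂ (L1 S) (L1 S) (NHom (L1 S) (L1 S)) (mulL S)).comp (mulL S)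
      = ((ContinuousLinearMap.compL ℂ (L1 S) (NHom (L1 S) (L1 S)) (NHom (L1 S) (L1 S))).flip
          (mulL S)).comp ((ContinuousLinearMap.compL ℂ (L1 S) (L1 S) (L1 S)).comp (mulL S)) := by
    refine hom_ext fun s => hom_ext fun t => hom_ext fun u => ?_
    change delta s * delta t * delta u = delta s * (delta t * delta u)
    simp only [delta_mul_delta, mul_assoc]
  exact congrArg (fun F => F f g h) e1

instance : NonUnitalRing (L1 S) where
  left_distrib := mul_add'
  right_distrib := add_mul'
  zero_mul f := by simpa using smul_mul' 0 (0 : L1 S) f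
  mul_zero f := by simpa using mul_smul' 0 f (0 : L1 S)
  mul_assoc := mul_assoc'

instance : NonUnitalNormedRing (L1 S) where
  dist_eq f g := NormedAddGroup.dist_eq f g
  norm_mul_le := norm_mul_le'

instance : IsScalarTower ℂ (L1 S) (L1 S) := ⟨fun c f g => smul_mul' c f g⟩

instance : SMulCommClass ℂ (L1 S) (L1 S) := ⟨fun c f g => (mul_smul' c f g).symm⟩

end Semigroup

end L1

end L1

/-- The set `{1, 2, 3, …}` of natural numbers, as the carrier of the semigroup `(ℕ, min)`. -/
structure NatMin : Type where
  val : ℕ+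

namespace NatMin

/-- The operation is the minimum. -/
instance : Mul NatMin := ⟨fun m n => ⟨min m.val n.val⟩⟩

instance : Semigroup NatMin where
  mul_assoc a b c := congrArg NatMin.mk (min_assoc a.val b.val c.val)

end NatMin

end

/-!
The obstruction is the one that keeps the `2 × 2` upper triangular matrices over `ℂ` from being
separable. Let `φ` be a weak*-continuous character of a dual Banach algebra `A` and `p ∈ A` an
idempotent with `φ p = 1`. On `Tri A` put `β t = φ (t.b)`, which is a character, and
`ξ t = φ (t.x)`. Then `ξ ⊗ β` and `β ⊗ β` lie in `σwc` (`tensorFunctional_mem_sigmaWC`), since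
their translates stay in a finite dimensional space and have weak*-continuous coefficients.

Let `e = (p, 0, p)` and `n = (0, p, 0)`, so that `n e = n = e n`. A bimodule morphism `ρ` satisfies
`n · ρ e = ρ n = ρ e · n`, and evaluating at `ξ ⊗ β` gives `(ρ e) (β ⊗ β) = 0`, because
`(ξ ⊗ β) · n = β ⊗ β` and `n · (ξ ⊗ β) = 0`. As `β` is multiplicative, `β ⊗ β = β ∘ π`, so
`β (π_σwc (ρ e)) = 0`, whereas `β e = 1`; thus `π_σwc (ρ e)` stays away from `e`
(`Tri.not_approximatelyConnesBiprojective`).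

For `F(ℓ¹(S))` the augmentation character `f ↦ ∑ f(s)` of `ℓ¹(S)` is weakly almost periodic and
provides `φ`; evaluation at the point mass of an idempotent of `S` provides `p`.
-/

noncomputable section

open Filter Topology

/-! ### Characters and idempotents of `F(A)` -/

section WAPDualCharacter

variable {A : Type u} [NonUnitalNormedRing A] [NormedSpace ℂ A] [IsScalarTower ℂ A A]
  [SMulCommClass ℂ A A]

/-- A character is weakly almost periodic: its two orbit maps have rank at most one. -/
theorem mem_WAP_of_map_mul {f : NDual A} (hf : ∀ x y, f (x * y) = f x * f y) : f ∈ WAP A := by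
  rw [mem_WAP_iff]
  intro X Y
  have h1 : Y.comp (rightOrbit f) = Y f • f := ContinuousLinearMap.ext fun a => by
    have h : rightOrbit f a = f a • f := ContinuousLinearMap.ext fun x => hf a x
    simp [h, mul_comm]
  have h2 : X.comp (leftOrbit f) = X f • f := ContinuousLinearMap.ext fun a => by
    have h : leftOrbit f a = f a • f := ContinuousLinearMap.ext fun x => by simp [hf, mul_comm]
    simp [h, mul_comm]
  rw [h1, h2, map_smul, map_smul, smul_eq_mul, smul_eq_mul, mul_comm]

namespace WAPDual

theorem evalW_map_mul (f : WAP A)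
    (hf : ∀ x y, (f : NDual A) (x * y) = (f : NDual A) x * (f : NDual A) y) (X Y : WAPDual A) :
    evalW A f (X * Y) = evalW A f X * evalW A f Y := by
  have h : bidualLeft (toDual A Y) f = toDual A Y f • f :=
    Subtype.ext <| ContinuousLinearMap.ext fun a => by
      have h' : rightOrbitW f a = (f : NDual A) a • f :=
        Subtype.ext <| ContinuousLinearMap.ext fun x => hf a x
      rw [bidualLeft_apply, h', map_smul, smul_eq_mul, mul_comm]
      rfl
  simp only [evalW_apply]
  rw [toDual_mul_apply, h, map_smul, smul_eq_mul, mul_comm]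

variable (A) in
/-- The canonical map `A → F(A)`, sending `a` to evaluation at `a`. -/
def ofAlg (a : A) : WAPDual A := (toDual A).symm (evalOn (WAP A) a)

theorem toDual_ofAlg (a : A) (f : WAP A) : toDual A (ofAlg A a) f = (f : NDual A) a := rfl

theorem ofAlg_mul (a b : A) : ofAlg A (a * b) = ofAlg A a * ofAlg A b :=
  ext_apply fun _ => rfl

end WAPDual

end WAPDualCharacter

/-! ### Elementary tensors of functionals in `σwc` -/

section TensorFunctional

open ProjTensor

/-- The functional `f ⊗ g` on `A ⊗̂ A`, with `(f ⊗ g)(x ⊗ y) = f x * g y`. -/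
def tensorFunctional {A : Type u} [NormedAddCommGroup A] [NormedSpace ℂ A] (f g : NDual A) :
    NDual (ProjTensor A) :=
  lift (f.smulRight g)

theorem tensorFunctional_tmul {A : Type u} [NormedAddCommGroup A] [NormedSpace ℂ A]
    (f g : NDual A) (x y : A) : tensorFunctional f g (tmul x y) = f x * g y :=
  lift_tmul _ x y

variable {A : Type u} [NonUnitalNormedRing A] [NormedSpace ℂ A] [IsScalarTower ℂ A A]
  [SMulCommClass ℂ A A]

theorem tensorFunctional_self [CompleteSpace A] {f : NDual A}
    (hf : ∀ x y, f (x * y) = f x * f y) : tensorFunctional f f = f.comp (prodMap A) :=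
  hom_ext fun x y => by
    rw [tensorFunctional_tmul, ContinuousLinearMap.comp_apply, prodMap_tmul, hf]

theorem dualLeft_tensorFunctional {f g : NDual A} (hg : ∀ x y, g (x * y) = g x * g y) (a : A) :
    dualLeft a (tensorFunctional f g) = g a • tensorFunctional f g :=
  hom_ext fun x y => by
    rw [dualLeft_apply, tensorRight_tmul, smul_apply, tensorFunctional_tmul,
      tensorFunctional_tmul, hg, smul_eq_mul]
    ring

theorem dualRight_tensorFunctional {f g k h : NDual A}
    (hf : ∀ x y, f (x * y) = h x * f y + f x * k y) (a : A) :
    dualRight a (tensorFunctional f g) =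
      h a • tensorFunctional f g + f a • tensorFunctional k g :=
  hom_ext fun x y => by
    rw [dualRight_apply, tensorLeft_tmul, add_apply, smul_apply,
      smul_apply, tensorFunctional_tmul, tensorFunctional_tmul, tensorFunctional_tmul, hf,
      smul_eq_mul, smul_eq_mul]
    ring

/-- If `g` is a weak*-continuous character and `f` is a weak*-continuous functional with
`f (x y) = h x * f y + f x * k y`, then `f ⊗ g` lies in `σwc((A ⊗̂ A)*)`. -/
theorem tensorFunctional_mem_sigmaWC [DualBanachAlgebra A] {f g h k : NDual A}
    (hf : f ∈ Predual A) (hg : g ∈ Predual A) (hh : h ∈ Predual A)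
    (hgm : ∀ x y, g (x * y) = g x * g y) (hfm : ∀ x y, f (x * y) = h x * f y + f x * k y) :
    tensorFunctional f g ∈ sigmaWC A := by
  rw [mem_sigmaWC_iff]
  intro Φ
  let _ := wkStarTopology A
  simp only [dualLeft_tensorFunctional hgm, dualRight_tensorFunctional hfm, map_add, map_smul,
    smul_eq_mul]
  exact ⟨(wkStar_continuous_predual hg).mul continuous_const,
    ((wkStar_continuous_predual hh).mul continuous_const).add
      ((wkStar_continuous_predual hf).mul continuous_const)⟩

end TensorFunctional

/-! ### Triangular algebras -/

section TriNotBiprojective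

variable {A : Type u} [NonUnitalNormedRing A] [NormedSpace ℂ A] [IsScalarTower ℂ A A]
  [SMulCommClass ℂ A A] [DualBanachAlgebra A]

/-- A bimodule morphism `ρ` on `Tri A` maps `(p, 0, p)` to a functional whose image under `π_σwc`
is annihilated by `t ↦ φ (t.b)`. -/
theorem Tri.character_prodSigmaWC_eq_zero {φ : NDual A} (hφ : φ ∈ Predual A)
    (hmul : ∀ x y, φ (x * y) = φ x * φ y) {p : A} (hp : p * p = p) (hφp : φ p = 1)
    {ρ : NHom (Tri A) (NDual (sigmaWC (Tri A)))} (hρ : IsBimoduleMorphism ρ) :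
    φ (prodSigmaWC (ρ ⟨p, 0, p⟩)).b = 0 := by
  let α : NDual (Tri A) := φ.comp (Tri.prA A)
  let ξ : NDual (Tri A) := φ.comp (Tri.prX A)
  let β : NDual (Tri A) := φ.comp (Tri.prB A)
  have hα : α ∈ Predual (Tri A) := Tri.comp_prA_mem hφ
  have hξ : ξ ∈ Predual (Tri A) := Tri.comp_prX_mem hφ
  have hβ : β ∈ Predual (Tri A) := Tri.comp_prB_mem hφ
  have hβm : ∀ s t, β (s * t) = β s * β t := fun s t => hmul s.b t.b
  have hξm : ∀ s t, ξ (s * t) = α s * ξ t + ξ s * β t := fun s t => by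
    change φ (s.a * t.x + s.x * t.b) = φ s.a * φ t.x + φ s.x * φ t.b
    rw [map_add, hmul, hmul]
  let T : sigmaWC (Tri A) :=
    ⟨tensorFunctional ξ β, tensorFunctional_mem_sigmaWC hξ hβ hα hβm hξm⟩
  let e : Tri A := ⟨p, 0, p⟩
  let n : Tri A := ⟨0, p, 0⟩
  have hne : n * e = e * n := by ext <;> simp [n, e, hp]
  have hl : sigmaLeft n T = 0 := Subtype.ext <| by
    change dualLeft n (tensorFunctional ξ β) = 0
    have hn : β n = 0 := map_zero φ
    rw [dualLeft_tensorFunctional hβm, hn]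
    exact zero_smul ℂ (tensorFunctional ξ β)
  have hr : sigmaRight n T = prodAdjoint (Tri A) ⟨β, hβ⟩ := Subtype.ext <| by
    change dualRight n (tensorFunctional ξ β) = β.comp (prodMap (Tri A))
    have hα0 : α n = 0 := map_zero φ
    have hξ1 : ξ n = 1 := hφp
    rw [dualRight_tensorFunctional hξm, hα0, hξ1, ← tensorFunctional_self hβm]
    exact (congrArg₂ (· + ·) (zero_smul ℂ (tensorFunctional ξ β))
      (one_smul ℂ (tensorFunctional β β))).trans (zero_add _)
  have hcomm : sigmaDualLeft n (ρ e) = sigmaDualRight (ρ e) n := by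
    rw [← hρ.map_left, ← hρ.map_right, hne]
  have key : ρ e (sigmaRight n T) = ρ e (sigmaLeft n T) := congrArg (fun M => M T) hcomm
  rw [hl, hr, map_zero] at key
  exact (apply_prodSigmaWC (ρ e) ⟨β, hβ⟩).trans key

/-- `Tri(A, A, A)` is not approximately Connes-biprojective as soon as `A` has a weak*-continuous
character that takes the value `1` at some idempotent. -/
theorem Tri.not_approximatelyConnesBiprojective {φ : NDual A} (hφ : φ ∈ Predual A)
    (hmul : ∀ x y, φ (x * y) = φ x * φ y) {p : A} (hp : p * p = p) (hφp : φ p = 1) :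
    ¬ ApproximatelyConnesBiprojective.{u, v} (Tri A) := by
  rintro ⟨ι, _, _, _, ρ, hρ, hlim⟩
  have h := ((φ.comp (Tri.prB A)).continuous.tendsto _).comp (hlim ⟨p, 0, p⟩)
  have h0 : (φ.comp (Tri.prB A)) ∘ (fun i => prodSigmaWC (ρ i ⟨p, 0, p⟩)) = fun _ => 0 :=
    funext fun i => Tri.character_prodSigmaWC_eq_zero hφ hmul hp hφp (hρ i)
  rw [h0] at h
  have h1 : (0 : ℂ) = φ p := tendsto_nhds_unique tendsto_const_nhds h
  exact zero_ne_one (h1.trans hφp)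

end TriNotBiprojective

/-! ### The augmentation character of `ℓ¹(S)` -/

namespace L1

variable (S : Type u)

/-- The augmentation `f ↦ ∑ f(s)` on `ℓ¹(S)`. -/
def augmentation : NDual (L1 S) :=
  LinearMap.mkContinuous
    { toFun := fun f => ∑' s, f s
      map_add' := fun f g =>
        (hasSum_norm f).summable.of_norm.tsum_add (hasSum_norm g).summable.of_norm
      map_smul' := fun c _ => tsum_mul_left (a := c) } 1 fun f => by
    rw [one_mul]
    exact tsum_of_norm_bounded (hasSum_norm f) fun _ => le_rfl

variable {S}

theorem augmentation_delta (s : S) : augmentation S (delta s) = 1 := by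
  change ∑' t, delta s t = 1
  rw [tsum_eq_single s fun t ht => delta_ne ht, delta_self]

theorem augmentation_mul [Semigroup S] (f g : L1 S) :
    augmentation S (f * g) = augmentation S f * augmentation S g := by
  have h : (ContinuousLinearMap.compL ℂ (L1 S) (L1 S) ℂ (augmentation S)).comp (mulL S) =
      (augmentation S).smulRight (augmentation S) := by
    refine hom_ext fun s => hom_ext fun t => ?_
    change augmentation S (delta s * delta t) =
      augmentation S (delta s) * augmentation S (delta t)
    simp only [delta_mul_delta, augmentation_delta, mul_one]
  exact congrArg (fun F => F f g) h

end L1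

end

/-- For `S = (ℕ, min)`, the dual Banach algebra `Tri(F(ℓ¹(S)), F(ℓ¹(S)), F(ℓ¹(S)))` is not
approximately Connes-biprojective, where `F(A) = WAP(A*)*`. -/
theorem mainTheorem8 :
    ¬ ApproximatelyConnesBiprojective.{0, v} (Tri (WAPDual (L1 NatMin))) := by
  let f : WAP (L1 NatMin) := ⟨L1.augmentation NatMin, mem_WAP_of_map_mul L1.augmentation_mul⟩
  refine Tri.not_approximatelyConnesBiprojective (φ := WAPDual.evalW (L1 NatMin) f) ⟨f, rfl⟩
    (WAPDual.evalW_map_mul f L1.augmentation_mul)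
    (p := WAPDual.ofAlg (L1 NatMin) (L1.delta ⟨1⟩)) ?_ (L1.augmentation_delta _)
  rw [← WAPDual.ofAlg_mul, L1.delta_mul_delta]
  rfl
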